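/- **Setting.** Fix a finite set $G$ of quantum gates (unitaries, each on some finite number of qubits) that is closed under inverses. A circuit is a finite sequence of gates from $G$, each applied to distinct wires. An LOCC channel from $k_A+k_B$ to $m_A+m_B$ qubits has a circuit description of size at most $c$ if it is obtained as follows: Alice holds her $k_A$ input qubits and $t_A$ ancillas, Bob holds his $k_B$ input qubits and $t_B$ ancillas, and they share a communication register of $q$ qubits; all ancillas and the register start in $|0\rangle$. In each of $r$ rounds Alice applies a circuit to her qubits and the register, the register is measured in the computational basis, Bob applies a circuit to his qubits and the register, and the register is measured again. The output is the first $m_A$ qubits of Alice and the first $m_B$ qubits of Bob, everything else being traced out. The size is the total number of gates, of created ancilla and register qubits, and of single-qubit measurements, and it has to be at most $c$. A family $\{\hat\Gamma^\lambda\}_{\lambda\in\mathbb N^+}$ of LOCC channels is *efficient* if $\hat\Gamma^\lambda$ has a circuit description of size at most $c(\lambda)$ for some polynomially bounded $c$. Let $F(\rho,\sigma)=\|\sqrt\rho\sqrt\sigma\|_1^2$, and let $\Phi^{\otimes n}$ be $n$ EPR pairs shared by Alice and Bob. For $\varepsilon:\mathbb N^+\to[0,1]$, a family of states $\rho^\lambda_{AB}$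 on $n_A(\lambda)+n_B(\lambda)$ qubits, and $n:\mathbb N^+\to\mathbb N^+$, write $\hat E_C^{\varepsilon}(\{\rho^\lambda_{AB}\})\le n(\lambda)$ (that is, $n$ is a valid upper bound on the computational one-shot entanglement cost) if there is an efficient family of LOCC channels with $1-F(\hat\Gamma^\lambda(\Phi^{\otimes n(\lambda)}),\rho^\lambda_{AB})\le\varepsilon(\lambda)$ for all $\lambda\in\mathbb N^+$. A family of local unitaries $U^\lambda_{AB}=U^\lambda_A\otimes U^\lambda_B$ is *efficient* if, for some polynomially bounded $c$, each $U^\lambda_{AB}$ is implemented (up to a global phase) by a circuit in which the number of gates plus the number of ancillas is at most $c(\lambda)$, the ancillas starting and ending in $|0\rangle$. **Theorem.** 1. Let $\varepsilon:\mathbb N^+\to[0,1]$, let $n_A,n_B:\mathbb N^+\to\mathbb N^+$ be polynomially bounded, let $\{\rho^\lambda_{AB}\}$ be a family of bipartite states on $n_A(\lambda)+n_B(\lambda)$ qubits and let $\{U^\lambda_{AB}\}$ be an efficient family of local unitaries. Then for every $n:\mathbb N^+\to\mathbb N^+$, $$\hat E^{\varepsilon}_C(\{\rho^{\lambda}_{AB}\})\le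 n(\lambda)\iff \hat E^{\varepsilon}_C(\{U^{\lambda}_{AB}\rho^{\lambda}_{AB}U^{\lambda\dagger}_{AB}\})\le n(\lambda).$$ 2. For general families of local unitaries this fails: let $\varepsilon:\mathbb N^+\to[0,1]$ be such that $1-\varepsilon(\lambda)\ge 1/p(\lambda)$ for all $\lambda$, for some polynomial $p$ that is positive on $\mathbb N^+$ (for instance any constant $\varepsilon<1$), and let $n:\mathbb N^+\to\mathbb N^+$ be polynomially bounded with $\log\lambda=o(n(\lambda))$ (for instance any non-constant polynomial). Then there is a family of local unitaries $U^\lambda_{AB}=U_A^\lambda\otimes U_B^\lambda$ on $n(\lambda)+n(\lambda)$ qubits such that $\hat E^{\varepsilon}_C(\{\Phi^{\otimes n(\lambda)}\})\le n(\lambda)$ holds but $\hat E^{\varepsilon}_C(\{U^{\lambda}_{AB}\Phi^{\otimes n(\lambda)}U^{\lambda\dagger}_{AB}\})\le n(\lambda)$ does not. -/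

import Mathlib

open scoped MatrixOrder ComplexOrder Kronecker

noncomputable section

/-! ### States, fidelity, EPR pairs -/

/-- Computational basis labels of a register of qubits whose wires are indexed by `W`. -/
abbrev Bits (W : Type) : Type := W → Fin 2

/-- Basis labels of a bipartite register with `a` qubits for Alice and `b` qubits for Bob. -/
abbrev BiBits (a b : ℕ) : Type := Bits (Fin a) × Bits (Fin b)

/-- Operators on `(ℂ²)^{⊗ a} ⊗ (ℂ²)^{⊗ b}`. -/
abbrev BiOp (a b : ℕ) : Type := Matrix (BiBits a b) (BiBits a b) ℂ

/-- Density matrices. -/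
def IsDensity {ι : Type} [Fintype ι] (ρ : Matrix ι ι ℂ) : Prop :=
  ρ.PosSemidef ∧ ρ.trace = 1

/-- The trace norm `‖A‖₁ = Tr |A|` with `|A| = √(A† A)`. -/
def traceNorm {ι : Type} [Fintype ι] [DecidableEq ι] (A : Matrix ι ι ℂ) : ℝ :=
  (Matrix.trace (CFC.abs A)).re

/-- The (squared) fidelity `F(ρ, σ) = ‖√ρ √σ‖₁²`. -/
def fidelity {ι : Type} [Fintype ι] [DecidableEq ι] (ρ σ : Matrix ι ι ℂ) : ℝ :=
  traceNorm (CFC.sqrt ρ * CFC.sqrt σ) ^ 2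

/-- Amplitudes of the EPR pair `(|00⟩ + |11⟩)/√2`. -/
def eprAmp (s t : Fin 2) : ℂ := if s = t then ((1 / Real.sqrt 2 : ℝ) : ℂ) else 0

/-- The vector of `n` EPR pairs, the first halves held by Alice and the second halves by Bob. -/
def eprVec (n : ℕ) : BiBits n n → ℂ := fun x => ∏ i, eprAmp (x.1 i) (x.2 i)

/-- The density matrix of `n` EPR pairs shared by Alice and Bob. -/
def eprState (n : ℕ) : BiOp n n := Matrix.vecMulVec (eprVec n) (star (eprVec n))

/-- Conjugation `ρ ↦ (U_A ⊗ U_B) ρ (U_A ⊗ U_B)†`. -/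
def localConj {a b : ℕ} (UA : Matrix.unitaryGroup (Bits (Fin a)) ℂ)
    (UB : Matrix.unitaryGroup (Bits (Fin b)) ℂ) (ρ : BiOp a b) : BiOp a b :=
  ((UA : Matrix (Bits (Fin a)) (Bits (Fin a)) ℂ) ⊗ₖ
      (UB : Matrix (Bits (Fin b)) (Bits (Fin b)) ℂ)) * ρ *
    ((UA : Matrix (Bits (Fin a)) (Bits (Fin a)) ℂ) ⊗ₖ
      (UB : Matrix (Bits (Fin b)) (Bits (Fin b)) ℂ)).conjTranspose

/-! ### Circuits over a gate set -/

/-- A gate: a number `k` of qubits together with a unitary on `k` qubits. -/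
abbrev Gate : Type := Σ k : ℕ, Matrix.unitaryGroup (Bits (Fin k)) ℂ

/-- A gate from the gate set `G`, applied to an ordered list of distinct wires of `W`. -/
structure PlacedGate (G : Set Gate) (W : Type) where
  gate : Gate
  mem : gate ∈ G
  wires : Fin gate.1 ↪ W

/-- A (unitary) circuit: a finite sequence of placed gates, applied from left to right. -/
abbrev Circuit (G : Set Gate) (W : Type) : Type := List (PlacedGate G W)

namespace PlacedGate

variable {G : Set Gate} {W W' : Type}

/-- Regard a gate on the wires `W` as a gate on a larger set of wires. -/
def map (f : W ↪ W') (g : PlacedGate G W) : PlacedGate G W' :=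
  ⟨g.gate, g.mem, g.wires.trans f⟩

/-- The operator of a placed gate: the gate on its wires, the identity on all other wires. -/
def toMatrix [Fintype W] [DecidableEq W] (g : PlacedGate G W) : Matrix (Bits W) (Bits W) ℂ :=
  fun x y =>
    if ∀ w, (∀ i, g.wires i ≠ w) → x w = y w then
      (g.gate.2 : Matrix (Bits (Fin g.gate.1)) (Bits (Fin g.gate.1)) ℂ)
        (fun i => x (g.wires i)) (fun i => y (g.wires i))
    else 0

end PlacedGate

/-- The operator of a circuit; the head of the list acts first. -/
def circuitMatrix {G : Set Gate} {W : Type} [Fintype W] [DecidableEq W] (C : Circuit G W) :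
    Matrix (Bits W) (Bits W) ℂ :=
  C.foldl (fun M g => g.toMatrix * M) 1

/-! ### LOCC circuits -/

/-- The circuit description of an LOCC channel from `kA + kB` to `mA + mB` qubits.
Alice holds `kA` input qubits followed by `tA` ancillas, Bob holds `kB` input qubits followed by
`tB` ancillas, and they share a communication register of `q` qubits. Every round consists of a
circuit of Alice on her qubits and the communication register, and of a circuit of Bob on his
qubits and the communication register. -/
structure LOCCCircuit (G : Set Gate) (kA kB mA mB : ℕ) where
  tA : ℕ
  tB : ℕ
  q : ℕ
  rounds : List (Circuit G (Fin (kA + tA) ⊕ Fin q) × Circuit G (Fin (kB + tB) ⊕ Fin q))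
  outA : mA ≤ kA + tA
  outB : mB ≤ kB + tB

namespace LOCCCircuit

variable {G : Set Gate} {kA kB mA mB : ℕ} (P : LOCCCircuit G kA kB mA mB)

/-- All wires: Alice's qubits, the communication register, Bob's qubits. -/
abbrev Wires : Type := Fin (kA + P.tA) ⊕ (Fin P.q ⊕ Fin (kB + P.tB))

/-- Operators on all wires. -/
abbrev Op : Type := Matrix (Bits P.Wires) (Bits P.Wires) ℂ

/-- The wires on which Alice acts. -/
def aliceWires : Fin (kA + P.tA) ⊕ Fin P.q ↪ P.Wires :=
  (Function.Embedding.refl _).sumMap Function.Embedding.inl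

/-- The wires on which Bob acts. -/
def bobWires : Fin (kB + P.tB) ⊕ Fin P.q ↪ P.Wires where
  toFun w := Sum.inr w.swap
  inj' _ _ h := Sum.swap_leftInverse.injective (Sum.inr_injective h)

/-- The total number of operations: gates, ancilla qubits created (including the communication
register), and single-qubit measurements (the communication register is measured twice in
each round). -/
def size : ℕ :=
  P.tA + P.tB + P.q + (P.rounds.map fun R => R.1.length + R.2.length + 2 * P.q).sum

/-- All ancillas and the communication register are in the state zero. -/
def AncillaZero (x : Bits P.Wires) : Prop :=
  (∀ i : Fin P.tA, x (Sum.inl (Fin.natAdd kA i)) = 0) ∧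
  (∀ i : Fin P.q, x (Sum.inr (Sum.inl i)) = 0) ∧
  (∀ i : Fin P.tB, x (Sum.inr (Sum.inr (Fin.natAdd kB i))) = 0)

instance : DecidablePred P.AncillaZero := fun x => by
  unfold AncillaZero; infer_instance

/-- The input part of a basis label. -/
def inputBits (x : Bits P.Wires) : BiBits kA kB :=
  (fun i => x (Sum.inl (Fin.castAdd P.tA i)), fun i => x (Sum.inr (Sum.inr (Fin.castAdd P.tB i))))

/-- The output part of a basis label: the first `mA` qubits of Alice, the first `mB` of Bob. -/
def outputBits (x : Bits P.Wires) : BiBits mA mB :=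
  (fun i => x (Sum.inl (Fin.castLE P.outA i)),
    fun i => x (Sum.inr (Sum.inr (Fin.castLE P.outB i))))

/-- Two basis labels agree on all wires that are discarded at the end. -/
def AgreeOffOutput (x y : Bits P.Wires) : Prop :=
  (∀ i : Fin (kA + P.tA), mA ≤ (i : ℕ) → x (Sum.inl i) = y (Sum.inl i)) ∧
  (∀ i : Fin P.q, x (Sum.inr (Sum.inl i)) = y (Sum.inr (Sum.inl i))) ∧
  (∀ i : Fin (kB + P.tB), mB ≤ (i : ℕ) → x (Sum.inr (Sum.inr i)) = y (Sum.inr (Sum.inr i)))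

instance (x y : Bits P.Wires) : Decidable (P.AgreeOffOutput x y) := by
  unfold AgreeOffOutput; infer_instance

/-- The input state, tensored with ancillas and communication register in the state zero. -/
def initial (σ : BiOp kA kB) : P.Op := fun x y =>
  if P.AncillaZero x ∧ P.AncillaZero y then σ (P.inputBits x) (P.inputBits y) else 0

/-- Measurement of the communication register in the computational basis; the outcome is kept in
that register. -/
def measure (τ : P.Op) : P.Op := fun x y =>
  if ∀ i : Fin P.q, x (Sum.inr (Sum.inl i)) = y (Sum.inr (Sum.inl i)) then τ x y else 0

/-- Apply a circuit to the state of all wires. -/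
def applyCircuit (C : Circuit G P.Wires) (τ : P.Op) : P.Op :=
  circuitMatrix C * τ * (circuitMatrix C).conjTranspose

/-- One round: Alice's circuit, measurement, Bob's circuit, measurement. -/
def round (τ : P.Op)
    (R : Circuit G (Fin (kA + P.tA) ⊕ Fin P.q) × Circuit G (Fin (kB + P.tB) ⊕ Fin P.q)) : P.Op :=
  P.measure (P.applyCircuit (R.2.map (PlacedGate.map P.bobWires))
    (P.measure (P.applyCircuit (R.1.map (PlacedGate.map P.aliceWires)) τ)))

/-- The partial trace over all wires that do not belong to the output. -/
def discard (τ : P.Op) : BiOp mA mB := fun a b =>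
  ∑ x, ∑ y, if P.outputBits x = a ∧ P.outputBits y = b ∧ P.AgreeOffOutput x y then τ x y else 0

/-- The channel that is described by the circuit. -/
def channel (σ : BiOp kA kB) : BiOp mA mB :=
  P.discard (P.rounds.foldl P.round (P.initial σ))

end LOCCCircuit

/-! ### Efficient families and the computational entanglement cost -/

/-- The function is bounded by a real polynomial in the parameter. -/
def PolyBounded (f : ℕ+ → ℕ) : Prop :=
  ∃ p : Polynomial ℝ, ∀ l : ℕ+, (f l : ℝ) ≤ p.eval ((l : ℕ) : ℝ)

/-- An efficient family of LOCC channels: each member has a circuit description, of polynomially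
bounded size. -/
def IsEfficientLOCC (G : Set Gate) {kA kB mA mB : ℕ+ → ℕ}
    (Γ : ∀ l, BiOp (kA l) (kB l) → BiOp (mA l) (mB l)) : Prop :=
  ∃ c : ℕ+ → ℕ, PolyBounded c ∧
    ∀ l, ∃ P : LOCCCircuit G (kA l) (kB l) (mA l) (mB l), P.channel = Γ l ∧ P.size ≤ c l

/-- `n` is a valid upper bound on the computational one-shot entanglement cost with error `ε` of
the family `ρ`. -/
def CostAtMost (G : Set Gate) (ε : ℕ+ → ℝ) {nA nB : ℕ+ → ℕ+} (ρ : ∀ l, BiOp (nA l) (nB l))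
    (n : ℕ+ → ℕ+) : Prop :=
  ∃ Γ : ∀ l, BiOp (n l) (n l) → BiOp (nA l) (nB l),
    IsEfficientLOCC G (kA := fun l => n l) (kB := fun l => n l)
      (mA := fun l => nA l) (mB := fun l => nB l) Γ ∧
    ∀ l, 1 - fidelity (Γ l (eprState (n l))) (ρ l) ≤ ε l

/-- The vector `ψ ⊗ |0…0⟩` on Alice's wires, Bob's wires and `t` ancilla wires. -/
def padAncilla {a b : ℕ} (t : ℕ) (ψ : BiBits a b → ℂ) :
    Bits (Fin a ⊕ (Fin b ⊕ Fin t)) → ℂ := fun x =>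
  if ∀ i : Fin t, x (Sum.inr (Sum.inr i)) = 0 then
    ψ (fun i => x (Sum.inl i), fun i => x (Sum.inr (Sum.inl i)))
  else 0

/-- The circuit `C` implements `U_A ⊗ U_B`, up to a global phase, with `t` ancillas that start and
end in the state zero. -/
def ImplementsLocal {G : Set Gate} {a b t : ℕ} (C : Circuit G (Fin a ⊕ (Fin b ⊕ Fin t)))
    (UA : Matrix.unitaryGroup (Bits (Fin a)) ℂ) (UB : Matrix.unitaryGroup (Bits (Fin b)) ℂ) :
    Prop :=
  ∃ z : ℂ, ‖z‖ = 1 ∧ ∀ ψ : BiBits a b → ℂ,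
    (circuitMatrix C).mulVec (padAncilla t ψ) =
      z • padAncilla t
        (((UA : Matrix (Bits (Fin a)) (Bits (Fin a)) ℂ) ⊗ₖ
          (UB : Matrix (Bits (Fin b)) (Bits (Fin b)) ℂ)).mulVec ψ)

/-- An efficient family of local unitaries `U_A ⊗ U_B`: circuits with polynomially many operations
(gates and ancilla creations). -/
def IsEfficientLocalUnitary (G : Set Gate) {nA nB : ℕ+ → ℕ+}
    (UA : ∀ l, Matrix.unitaryGroup (Bits (Fin (nA l))) ℂ)
    (UB : ∀ l, Matrix.unitaryGroup (Bits (Fin (nB l))) ℂ) : Prop :=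
  ∃ c : ℕ+ → ℕ, PolyBounded c ∧
    ∀ l, ∃ (t : ℕ) (C : Circuit G (Fin (nA l) ⊕ (Fin (nB l) ⊕ Fin t))),
      ImplementsLocal C (UA l) (UB l) ∧ C.length + t ≤ c l

end

/-!
**Efficient local unitaries.** Let `C` be an efficient circuit for `U_A ⊗ U_B`. It may contain gates
across the two parties, so it is not an LOCC operation. But Alice can run all of `C` on her output
qubits and on fresh ancillas that play the role of Bob's qubits: up to a global phase this applies
`U_A` and leaves the pure state `U_B |0…0⟩` on the ancillas, which is traced out. Bob does the same
with the roles exchanged. Appending this round (`LOCCCircuit.appendLocal`) to a circuit conjugates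
its channel by `U_A ⊗ U_B` (`LOCCCircuit.channel_appendLocal`), and the fidelity is invariant under
this conjugation. For the converse one runs `C` backwards, which is possible since the gate set is
closed under inverses.

To compare the two circuits, an operator on some of the wires is written as `liftOp f M` for an
embedding `f` of wires, and the creation of ancillas is the isometry `padOp f`. On the ancillas and
the output of the appended round, the two copies of `C` factor as `U_A ⊗ U_B` after an isometry that
attaches a pure state, and such an isometry drops out of the partial trace (`ptr_isometry_conj`).

**General local unitaries.** The counterexample is a counting argument. The wires of a circuit of
size at most `s` and its at most `s` elementary steps can be encoded in `exp (poly s)` many ways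
(`LOCCCircuit.card_code_le`), so at most that many states arise from the EPR pairs. On the other
side, identify the labels of one half of Alice's qubits with a field `F`, those of the other half
with `F` again, and apply to Alice's halves of the EPR pairs the phases `ψ (p(a) b)`, for an additive
character `ψ` and a polynomial `p` of degree less than `D`. Two such states have overlap at most
`D / |F|`, because different polynomials agree in at most `D` points
(`norm_dotProduct_phase_le`). By the Cauchy-Schwarz inequality a density matrix can have overlap at
least `θ` with only `O(θ⁻²)` of such almost orthogonal states (`card_overlap_le`), while there are
`|F| ^ D` polynomials. As `log λ = o(n)`, the field has superpolynomial size, and for every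
polynomial `s` one of the phase states is not approximated by any circuit of size `s(λ)`
(`eventually_exists_isHard`). A diagonal argument over the exponents of the polynomials gives one
family that works for all of them (`exists_not_costAtMost`).
-/

set_option linter.unusedSectionVars false

noncomputable section

/-! ### Operators acting on some of the wires -/

section Lift

variable {U V W : Type}

/-- Two basis labels agree on all wires outside the range of `f`. -/
def AgreeOff (f : V ↪ W) (x y : Bits W) : Prop := ∀ w, (∀ i, f i ≠ w) → x w = y w

theorem agreeOff_iff_eq_extend {f : V ↪ W} {x y : Bits W} :
    AgreeOff f x y ↔ y = Function.extend f (y ∘ f) x := by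
  constructor
  · intro h
    ext1 w
    by_cases hw : ∃ i, f i = w
    · obtain ⟨i, rfl⟩ := hw
      rw [f.injective.extend_apply]
      rfl
    · rw [Function.extend_apply' _ _ _ hw, h w (not_exists.1 hw)]
  · intro h w hw
    rw [h, Function.extend_apply' _ _ _ (not_exists.2 hw)]

theorem agreeOff_extend (f : V ↪ W) (v : Bits V) (x : Bits W) :
    AgreeOff f (Function.extend f v x) x := fun _ hw =>
  Function.extend_apply' _ _ _ (not_exists.2 hw)

theorem AgreeOff.symm {f : V ↪ W} {x y : Bits W} (h : AgreeOff f x y) : AgreeOff f y x :=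
  fun w hw => (h w hw).symm

theorem AgreeOff.trans {f : V ↪ W} {x y z : Bits W} (h : AgreeOff f x y) (h' : AgreeOff f y z) :
    AgreeOff f x z :=
  fun w hw => (h w hw).trans (h' w hw)

theorem AgreeOff.eq {f : V ↪ W} {x y : Bits W} (h : AgreeOff f x y) (h' : x ∘ f = y ∘ f) :
    x = y := by
  ext1 w
  by_cases hw : ∃ i, f i = w
  · obtain ⟨i, rfl⟩ := hw
    exact congrFun h' i
  · exact h w (not_exists.1 hw)

theorem agreeOff_trans_iff {g : U ↪ V} {f : V ↪ W} {x y : Bits W} :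
    AgreeOff (g.trans f) x y ↔ AgreeOff f x y ∧ AgreeOff g (x ∘ f) (y ∘ f) := by
  constructor
  · intro h
    refine ⟨fun w hw => h w fun i => hw _, fun v hv => h (f v) fun i hi => hv i (f.injective hi)⟩
  · rintro ⟨h, h'⟩ w hw
    by_cases hf : ∃ i, f i = w
    · obtain ⟨v, rfl⟩ := hf
      exact h' v fun i hi => hw i (congrArg f hi)
    · exact h w (not_exists.1 hf)

variable [Fintype U] [Fintype V] [Fintype W] [DecidableEq U] [DecidableEq V] [DecidableEq W]

open Classical in
/-- The operator `M` applied to the wires in the range of `f`, the identity on all others. -/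
def liftOp (f : V ↪ W) (M : Matrix (Bits V) (Bits V) ℂ) : Matrix (Bits W) (Bits W) ℂ :=
  fun x y => if AgreeOff f x y then M (x ∘ f) (y ∘ f) else 0

/-- In a row of `liftOp f M`, only the labels that differ from the row label on the wires of `f`
contribute. -/
theorem sum_liftOp_mul (f : V ↪ W) (M : Matrix (Bits V) (Bits V) ℂ) (x : Bits W)
    (h : Bits W → ℂ) :
    ∑ y, liftOp f M x y * h y = ∑ v, M (x ∘ f) v * h (Function.extend f v x) := by
  symm
  refine Finset.sum_of_injOn (fun v => Function.extend f v x) ?_ (by simp) ?_ ?_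
  · intro v _ v' _ hv
    have := congrArg (· ∘ f) hv
    simpa [Function.extend_comp f.injective] using this
  · intro y _ hy
    have : ¬ AgreeOff f x y := fun hxy => hy ⟨y ∘ f, by simp, (agreeOff_iff_eq_extend.1 hxy).symm⟩
    simp [liftOp, this]
  · intro v _
    simp [liftOp, (agreeOff_extend f v x).symm, Function.extend_comp f.injective]

theorem liftOp_mul (f : V ↪ W) (M N : Matrix (Bits V) (Bits V) ℂ) :
    liftOp f (M * N) = liftOp f M * liftOp f N := by
  ext x z
  rw [Matrix.mul_apply, sum_liftOp_mul f M x fun y => liftOp f N y z]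
  have h : ∀ v, AgreeOff f (Function.extend f v x) z ↔ AgreeOff f x z := fun v =>
    ⟨(agreeOff_extend f v x).symm.trans, (agreeOff_extend f v x).trans⟩
  by_cases hxz : AgreeOff f x z
  · simp [liftOp, h, hxz, Matrix.mul_apply, Function.extend_comp f.injective]
  · simp [liftOp, h, hxz]

theorem liftOp_one (f : V ↪ W) : liftOp f (1 : Matrix (Bits V) (Bits V) ℂ) = 1 := by
  ext x y
  by_cases hxy : x = y
  · subst hxy
    simp [liftOp, AgreeOff]
  · by_cases h : AgreeOff f x y
    · have : x ∘ f ≠ y ∘ f := fun h' => hxy (h.eq h')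
      simp [liftOp, hxy, this]
    · simp [liftOp, hxy, h]

theorem liftOp_conjTranspose (f : V ↪ W) (M : Matrix (Bits V) (Bits V) ℂ) :
    liftOp f M.conjTranspose = (liftOp f M).conjTranspose := by
  ext x y
  have h : AgreeOff f x y ↔ AgreeOff f y x := ⟨AgreeOff.symm, AgreeOff.symm⟩
  by_cases hxy : AgreeOff f y x <;> simp [liftOp, h, hxy]

theorem liftOp_liftOp (g : U ↪ V) (f : V ↪ W) (M : Matrix (Bits U) (Bits U) ℂ) :
    liftOp f (liftOp g M) = liftOp (g.trans f) M := by
  ext x y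
  by_cases h : AgreeOff f x y <;> by_cases h' : AgreeOff g (x ∘ f) (y ∘ f) <;>
    simp only [liftOp, agreeOff_trans_iff, h, h', and_self, and_true, and_false, if_true, if_false]
  rfl

/-- Operators on disjoint sets of wires multiply entrywise. -/
theorem liftOp_mul_liftOp_apply {f : U ↪ W} {g : V ↪ W} (hfg : ∀ i j, f i ≠ g j)
    (M : Matrix (Bits U) (Bits U) ℂ) (N : Matrix (Bits V) (Bits V) ℂ) (x y : Bits W)
    [Decidable (∀ w, (∀ i, f i ≠ w) → (∀ j, g j ≠ w) → x w = y w)] :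
    (liftOp f M * liftOp g N) x y =
      if ∀ w, (∀ i, f i ≠ w) → (∀ j, g j ≠ w) → x w = y w then
        M (x ∘ f) (y ∘ f) * N (x ∘ g) (y ∘ g) else 0 := by
  rw [Matrix.mul_apply, sum_liftOp_mul f M x fun z => liftOp g N z y]
  have hg : ∀ v, Function.extend f v x ∘ g = x ∘ g := fun v => by
    ext1 j
    exact Function.extend_apply' _ _ _ fun ⟨i, hi⟩ => hfg i j hi
  have h : ∀ v, AgreeOff g (Function.extend f v x) y ↔
      v = y ∘ f ∧ ∀ w, (∀ i, f i ≠ w) → (∀ j, g j ≠ w) → x w = y w := fun v => by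
    constructor
    · intro h
      refine ⟨?_, fun w hw hw' => ?_⟩
      · ext1 i
        have := h (f i) fun j hj => hfg i j hj.symm
        rwa [f.injective.extend_apply] at this
      · have := h w hw'
        rwa [Function.extend_apply' _ _ _ (not_exists.2 hw)] at this
    · rintro ⟨rfl, h⟩ w hw
      by_cases hf : ∃ i, f i = w
      · obtain ⟨i, rfl⟩ := hf
        rw [f.injective.extend_apply]
        rfl
      · rw [Function.extend_apply' _ _ _ hf]
        exact h w (not_exists.1 hf) hw
  rw [Finset.sum_eq_single (y ∘ f)]
  · simp [liftOp, h, hg]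
  · intro v _ hv
    simp [liftOp, h, hv]
  · simp

/-- The isometry that adds the wires outside the range of `f` in the state zero. -/
def padOp (f : V ↪ W) : Matrix (Bits W) (Bits V) ℂ :=
  fun x y => if x = Function.extend f y 0 then 1 else 0

theorem extend_injective (f : V ↪ W) (x : Bits W) :
    Function.Injective fun v : Bits V => Function.extend f v x := fun v v' hv => by
  have := congrArg (· ∘ f) hv
  simpa [Function.extend_comp f.injective] using this

theorem conjTranspose_padOp_mul_padOp (f : V ↪ W) :
    (padOp f).conjTranspose * padOp f = 1 := by
  ext x y
  simp [Matrix.mul_apply, padOp, Matrix.one_apply, (extend_injective f 0).eq_iff, eq_comm]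

theorem mul_padOp_apply (f : V ↪ W) (M : Matrix (Bits W) (Bits W) ℂ) (x : Bits W) (y : Bits V) :
    (M * padOp f) x y = M x (Function.extend f y 0) := by
  simp [Matrix.mul_apply, padOp]

theorem eq_extend_zero_iff {f : V ↪ W} {x : Bits W} {v : Bits V} :
    x = Function.extend f v 0 ↔ v = x ∘ f ∧ AgreeOff f x 0 := by
  constructor
  · rintro rfl
    exact ⟨(Function.extend_comp f.injective _ _).symm, agreeOff_extend f v 0⟩
  · rintro ⟨rfl, h⟩
    exact agreeOff_iff_eq_extend.1 h.symm

theorem liftOp_mul_padOp (f : V ↪ W) (M : Matrix (Bits V) (Bits V) ℂ) :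
    liftOp f M * padOp f = padOp f * M := by
  ext x y
  rw [mul_padOp_apply, Matrix.mul_apply]
  have h' : AgreeOff f x (Function.extend f y 0) ↔ AgreeOff f x 0 :=
    ⟨fun h => h.trans (agreeOff_extend f y 0), fun h => h.trans (agreeOff_extend f y 0).symm⟩
  by_cases hx : AgreeOff f x 0
  · simp [padOp, liftOp, eq_extend_zero_iff, h', hx, Function.extend_comp f.injective]
  · simp [padOp, liftOp, eq_extend_zero_iff, h', hx]

theorem padOp_conj_apply (f : V ↪ W) (τ : Matrix (Bits V) (Bits V) ℂ) (x y : Bits W)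
    [Decidable (AgreeOff f x 0 ∧ AgreeOff f y 0)] :
    (padOp f * τ * (padOp f).conjTranspose) x y =
      if AgreeOff f x 0 ∧ AgreeOff f y 0 then τ (x ∘ f) (y ∘ f) else 0 := by
  by_cases hx : AgreeOff f x 0 <;> by_cases hy : AgreeOff f y 0 <;>
    simp [Matrix.mul_apply, padOp, eq_extend_zero_iff, hx, hy, apply_ite]

end Lift

/-! ### Circuits as operators -/

section Circuits

variable {G : Set Gate} {W W' : Type} [Fintype W] [DecidableEq W] [Fintype W'] [DecidableEq W']

theorem PlacedGate.toMatrix_eq_liftOp (g : PlacedGate G W) :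
    g.toMatrix =
      liftOp g.wires (g.gate.2 : Matrix (Bits (Fin g.gate.1)) (Bits (Fin g.gate.1)) ℂ) := by
  ext x y
  simp only [PlacedGate.toMatrix, liftOp, AgreeOff]
  congr

theorem PlacedGate.toMatrix_map (f : W ↪ W') (g : PlacedGate G W) :
    (g.map f).toMatrix = liftOp f g.toMatrix := by
  rw [toMatrix_eq_liftOp, toMatrix_eq_liftOp, liftOp_liftOp]
  rfl

theorem circuitMatrix_nil : circuitMatrix ([] : Circuit G W) = 1 := rfl

theorem circuitMatrix_foldl (C : Circuit G W) (M : Matrix (Bits W) (Bits W) ℂ) :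
    C.foldl (fun M g => g.toMatrix * M) M = circuitMatrix C * M := by
  induction C generalizing M with
  | nil => simp [circuitMatrix]
  | cons g C ih =>
    rw [circuitMatrix, List.foldl_cons, List.foldl_cons, ih, ih (g.toMatrix * 1), mul_one,
      mul_assoc]

theorem circuitMatrix_cons (g : PlacedGate G W) (C : Circuit G W) :
    circuitMatrix (g :: C) = circuitMatrix C * g.toMatrix := by
  rw [circuitMatrix, List.foldl_cons, circuitMatrix_foldl, mul_one]

theorem circuitMatrix_append (C D : Circuit G W) :
    circuitMatrix (C ++ D) = circuitMatrix D * circuitMatrix C := by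
  rw [circuitMatrix, List.foldl_append, circuitMatrix_foldl]
  rfl

theorem circuitMatrix_map (f : W ↪ W') (C : Circuit G W) :
    circuitMatrix (C.map (PlacedGate.map f)) = liftOp f (circuitMatrix C) := by
  induction C with
  | nil => simp [circuitMatrix_nil, liftOp_one]
  | cons g C ih =>
    rw [List.map_cons, circuitMatrix_cons, circuitMatrix_cons, liftOp_mul, ih,
      PlacedGate.toMatrix_map]

theorem PlacedGate.conjTranspose_mul_toMatrix (g : PlacedGate G W) :
    g.toMatrix.conjTranspose * g.toMatrix = 1 := by
  rw [toMatrix_eq_liftOp, ← liftOp_conjTranspose, ← liftOp_mul,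
    ← Matrix.star_eq_conjTranspose, Unitary.coe_star_mul_self, liftOp_one]

theorem conjTranspose_mul_circuitMatrix (C : Circuit G W) :
    (circuitMatrix C).conjTranspose * circuitMatrix C = 1 := by
  induction C with
  | nil => simp [circuitMatrix_nil]
  | cons g C ih =>
    rw [circuitMatrix_cons, Matrix.conjTranspose_mul, mul_assoc,
      ← mul_assoc (circuitMatrix C).conjTranspose, ih, one_mul, g.conjTranspose_mul_toMatrix]

/-- For a gate set that is closed under inverses, circuits can be run backwards. -/
theorem exists_circuitMatrix_eq_conjTranspose
    (hinv : ∀ g ∈ G, (⟨g.1, g.2⁻¹⟩ : Gate) ∈ G) (C : Circuit G W) :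
    ∃ D : Circuit G W, D.length = C.length ∧
      circuitMatrix D = (circuitMatrix C).conjTranspose := by
  induction C with
  | nil => exact ⟨[], rfl, by simp [circuitMatrix_nil]⟩
  | cons g C ih =>
    obtain ⟨D, hD, hDC⟩ := ih
    let g' : PlacedGate G W := ⟨⟨g.gate.1, g.gate.2⁻¹⟩, hinv _ g.mem, g.wires⟩
    have hg' : circuitMatrix [g'] = g.toMatrix.conjTranspose := by
      rw [circuitMatrix_cons, circuitMatrix_nil, one_mul, PlacedGate.toMatrix_eq_liftOp,
        PlacedGate.toMatrix_eq_liftOp, ← liftOp_conjTranspose]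
      rfl
    refine ⟨D ++ [g'], by simp [hD], ?_⟩
    rw [circuitMatrix_append, hDC, hg', circuitMatrix_cons, Matrix.conjTranspose_mul]

end Circuits

/-! ### Fidelity -/

section Fidelity

open Matrix

variable {ι : Type} [Fintype ι] [DecidableEq ι]

/-- This holds for every matrix `A`: if `A` is not positive semidefinite, both square roots are zero
by convention. -/
theorem sqrt_unitary_conj {U : Matrix ι ι ℂ} (hU : Uᴴ * U = 1) (A : Matrix ι ι ℂ) :
    CFC.sqrt (U * A * Uᴴ) = U * CFC.sqrt A * Uᴴ := by
  by_cases hA : 0 ≤ A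
  · refine CFC.sqrt_unique ?_ ?_
    · calc U * CFC.sqrt A * Uᴴ * (U * CFC.sqrt A * Uᴴ)
          = U * CFC.sqrt A * (Uᴴ * U) * CFC.sqrt A * Uᴴ := by simp only [Matrix.mul_assoc]
        _ = U * (CFC.sqrt A * CFC.sqrt A) * Uᴴ := by
          rw [hU, Matrix.mul_one]; simp only [Matrix.mul_assoc]
        _ = U * A * Uᴴ := by rw [CFC.sqrt_mul_sqrt_self A hA]
    · exact nonneg_iff_posSemidef.2
        ((nonneg_iff_posSemidef.1 (CFC.sqrt_nonneg A)).mul_mul_conjTranspose_same U)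
  · have hA' : ¬ 0 ≤ U * A * Uᴴ := fun h => hA <| by
      have := (nonneg_iff_posSemidef.1 h).conjTranspose_mul_mul_same U
      have e : Uᴴ * (U * A * Uᴴ) * U = A := by
        calc Uᴴ * (U * A * Uᴴ) * U = (Uᴴ * U) * A * (Uᴴ * U) := by simp only [Matrix.mul_assoc]
          _ = A := by rw [hU, Matrix.one_mul, Matrix.mul_one]
      exact nonneg_iff_posSemidef.2 (e ▸ this)
    rw [CFC.sqrt_of_not_nonneg hA, CFC.sqrt_of_not_nonneg hA', Matrix.mul_zero, Matrix.zero_mul]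

/-- The fidelity does not change when both states are conjugated by the same unitary. -/
theorem fidelity_unitary_conj {U : Matrix ι ι ℂ} (hU : Uᴴ * U = 1) (ρ σ : Matrix ι ι ℂ) :
    fidelity (U * ρ * Uᴴ) (U * σ * Uᴴ) = fidelity ρ σ := by
  have h : CFC.sqrt (U * ρ * Uᴴ) * CFC.sqrt (U * σ * Uᴴ) =
      U * (CFC.sqrt ρ * CFC.sqrt σ) * Uᴴ := by
    rw [sqrt_unitary_conj hU, sqrt_unitary_conj hU]
    calc U * CFC.sqrt ρ * Uᴴ * (U * CFC.sqrt σ * Uᴴ)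
        = U * CFC.sqrt ρ * (Uᴴ * U) * CFC.sqrt σ * Uᴴ := by simp only [Matrix.mul_assoc]
      _ = _ := by rw [hU, Matrix.mul_one]; simp only [Matrix.mul_assoc]
  have h' : ∀ A : Matrix ι ι ℂ, CFC.abs (U * A * Uᴴ) = U * CFC.abs A * Uᴴ := fun A => by
    rw [CFC.abs, CFC.abs, ← sqrt_unitary_conj hU, star_eq_conjTranspose, star_eq_conjTranspose]
    congr 1
    rw [conjTranspose_mul, conjTranspose_mul, conjTranspose_conjTranspose]
    calc U * (Aᴴ * Uᴴ) * (U * A * Uᴴ) = U * Aᴴ * (Uᴴ * U) * A * Uᴴ := by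
          simp only [Matrix.mul_assoc]
      _ = _ := by rw [hU, Matrix.mul_one]; simp only [Matrix.mul_assoc]
  rw [fidelity, fidelity, h, traceNorm, traceNorm, h', trace_mul_comm, ← Matrix.mul_assoc, hU,
    Matrix.one_mul]

/-- The square root of a matrix that is not positive semidefinite is zero by convention, so in lower
bounds on the fidelity positivity need not be assumed. -/
theorem fidelity_of_not_posSemidef {σ : Matrix ι ι ℂ} (hσ : ¬ σ.PosSemidef) (ρ : Matrix ι ι ℂ) :
    fidelity σ ρ = 0 := by
  rw [fidelity, CFC.sqrt_of_not_nonneg (mt nonneg_iff_posSemidef.1 hσ), Matrix.zero_mul, traceNorm,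
    CFC.abs, star_zero, Matrix.zero_mul, CFC.sqrt_zero, trace_zero]
  simp

/-- The fidelity with a pure state `|φ⟩` is the overlap `⟨φ|σ|φ⟩`. -/
theorem fidelity_pure {σ : Matrix ι ι ℂ} (hσ : σ.PosSemidef) {φ : ι → ℂ} (hφ : star φ ⬝ᵥ φ = 1) :
    fidelity σ (vecMulVec φ (star φ)) = (star φ ⬝ᵥ σ *ᵥ φ).re := by
  set Q := vecMulVec φ (star φ) with hQ
  have hQQ : Q * Q = Q := by
    rw [hQ, vecMulVec_mul_vecMulVec, hφ, one_smul]
  have hQ0 : 0 ≤ Q := nonneg_iff_posSemidef.2 (posSemidef_vecMulVec_self_star φ)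
  have hsQ : CFC.sqrt Q = Q := CFC.sqrt_unique hQQ hQ0
  have hs0 := nonneg_iff_posSemidef.1 (CFC.sqrt_nonneg σ)
  have hQH : Qᴴ = Q := (nonneg_iff_posSemidef.1 hQ0).1
  have hc := hσ.dotProduct_mulVec_nonneg φ
  set c := (star φ ⬝ᵥ σ *ᵥ φ).re with hcdef
  have hcc : star φ ⬝ᵥ σ *ᵥ φ = (c : ℂ) := by
    rw [hcdef]; exact (Complex.eq_re_of_ofReal_le hc).trans (by simp)
  have hc0 : 0 ≤ c := by rw [hcc] at hc; exact_mod_cast hc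
  have habs : CFC.abs (CFC.sqrt σ * Q) = ((Real.sqrt c : ℝ) : ℂ) • Q := by
    rw [CFC.abs]
    refine CFC.sqrt_unique ?_ ?_
    · rw [star_eq_conjTranspose, conjTranspose_mul, hs0.1.eq, hQH, smul_mul_smul_comm, hQQ]
      have : Q * CFC.sqrt σ * (CFC.sqrt σ * Q) = Q * σ * Q := by
        rw [← Matrix.mul_assoc, Matrix.mul_assoc Q, CFC.sqrt_mul_sqrt_self σ
          (nonneg_iff_posSemidef.2 hσ)]
      rw [this, ← Complex.ofReal_mul, Real.mul_self_sqrt hc0, ← hcc, hQ, Matrix.mul_assoc,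
        mul_vecMulVec, vecMulVec_mul_vecMulVec, vecMulVec_smul]
    · refine nonneg_iff_posSemidef.2 ((nonneg_iff_posSemidef.1 hQ0).smul ?_)
      exact_mod_cast Real.sqrt_nonneg c
  rw [fidelity, hsQ, traceNorm, habs, trace_smul, hQ, trace_vecMulVec, dotProduct_comm, hφ]
  simp [Real.sq_sqrt hc0]

theorem norm_sum_mul_sq_le {κ : Type*} (s : Finset κ) (a b : κ → ℂ) :
    ‖∑ i ∈ s, a i * b i‖ ^ 2 ≤ (∑ i ∈ s, ‖a i‖ ^ 2) * ∑ i ∈ s, ‖b i‖ ^ 2 := by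
  calc ‖∑ i ∈ s, a i * b i‖ ^ 2 ≤ (∑ i ∈ s, ‖a i‖ * ‖b i‖) ^ 2 := by
        gcongr
        exact (norm_sum_le _ _).trans_eq (by simp)
    _ ≤ _ := Finset.sum_mul_sq_le_sq_mul_sq _ _ _

/-- A density matrix has Frobenius norm at most one. -/
theorem sum_norm_sq_le_one {σ : Matrix ι ι ℂ} (hσ : σ.PosSemidef) (htr : σ.trace = 1) :
    ∑ x, ∑ y, ‖σ x y‖ ^ 2 ≤ 1 := by
  set B := CFC.sqrt σ
  have hB : Bᴴ = B := (nonneg_iff_posSemidef.1 (CFC.sqrt_nonneg σ)).1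
  have hBB : σ = Bᴴ * B := by
    rw [hB]; exact (CFC.sqrt_mul_sqrt_self σ (nonneg_iff_posSemidef.2 hσ)).symm
  have hdiag : ∀ x, σ x x = ((∑ z, ‖B z x‖ ^ 2 : ℝ) : ℂ) := fun x => by
    rw [hBB, Matrix.mul_apply]
    push_cast
    refine Finset.sum_congr rfl fun z _ => ?_
    rw [conjTranspose_apply, ← Complex.conj_mul']
    rfl
  have hsum : ∑ x, ∑ z, ‖B z x‖ ^ 2 = 1 := by
    have : ((∑ x, ∑ z, ‖B z x‖ ^ 2 : ℝ) : ℂ) = 1 := by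
      rw [← htr, trace, Complex.ofReal_sum]
      exact Finset.sum_congr rfl fun x _ => (hdiag x).symm
    exact_mod_cast this
  calc ∑ x, ∑ y, ‖σ x y‖ ^ 2
      ≤ ∑ x, ∑ y, (∑ z, ‖B z x‖ ^ 2) * ∑ z, ‖B z y‖ ^ 2 := by
        refine Finset.sum_le_sum fun x _ => Finset.sum_le_sum fun y _ => ?_
        rw [hBB, Matrix.mul_apply]
        refine (norm_sum_mul_sq_le _ _ _).trans_eq ?_
        simp
    _ = 1 := by
      simp_rw [← Finset.mul_sum, ← Finset.sum_mul, hsum, mul_one]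

/-- A single density matrix has overlap at least `θ` with only few of a family of almost orthogonal
pure states. -/
theorem card_overlap_le {κ : Type*} [DecidableEq κ] {σ : Matrix ι ι ℂ} (hσ : σ.PosSemidef)
    (htr : σ.trace = 1) (S : Finset κ) (φ : κ → ι → ℂ) (hφ : ∀ i, star (φ i) ⬝ᵥ φ i = 1) {δ θ : ℝ}
    (hδ0 : 0 ≤ δ) (hδ : ∀ i j, i ≠ j → ‖star (φ i) ⬝ᵥ φ j‖ ^ 2 ≤ δ)
    (hθ : 0 ≤ θ) (hS : ∀ i ∈ S, θ ≤ (star (φ i) ⬝ᵥ σ *ᵥ φ i).re) :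
    (S.card * θ) ^ 2 ≤ S.card + S.card ^ 2 * δ := by
  -- The sum of the overlaps is `Tr (σ T)` with `T = ∑ |φ i⟩⟨φ i|`. The Cauchy-Schwarz inequality
  -- bounds it by Frobenius norms, and that of `T` is given by the Gram matrix of the `φ i`.
  set T : ι → ι → ℂ := fun x y => ∑ i ∈ S, star (φ i x) * φ i y with hT
  have h1 : S.card * θ ≤ ‖∑ p : ι × ι, σ p.1 p.2 * T p.1 p.2‖ := by
    calc S.card * θ = ∑ i ∈ S, θ := by simp
      _ ≤ ∑ i ∈ S, (star (φ i) ⬝ᵥ σ *ᵥ φ i).re := Finset.sum_le_sum hS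
      _ = (∑ i ∈ S, star (φ i) ⬝ᵥ σ *ᵥ φ i).re := (Complex.re_sum _ _).symm
      _ ≤ ‖∑ i ∈ S, star (φ i) ⬝ᵥ σ *ᵥ φ i‖ := Complex.re_le_norm _
      _ = _ := by
        congr 1
        simp only [hT, Finset.mul_sum, dotProduct, mulVec, Fintype.sum_prod_type]
        rw [Finset.sum_comm]
        refine Finset.sum_congr rfl fun x _ => ?_
        rw [Finset.sum_comm]
        refine Finset.sum_congr rfl fun y _ => Finset.sum_congr rfl fun i _ => ?_
        simp only [Pi.star_apply]
        ring
  have h2 : ∑ p : ι × ι, ‖T p.1 p.2‖ ^ 2 = ∑ i ∈ S, ∑ j ∈ S, ‖star (φ i) ⬝ᵥ φ j‖ ^ 2 := by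
    have : ((∑ p : ι × ι, ‖T p.1 p.2‖ ^ 2 : ℝ) : ℂ) =
        ((∑ i ∈ S, ∑ j ∈ S, ‖star (φ i) ⬝ᵥ φ j‖ ^ 2 : ℝ) : ℂ) := by
      push_cast
      simp only [← Complex.mul_conj', hT, dotProduct, map_sum, map_mul, Finset.sum_mul_sum,
        Fintype.sum_prod_type]
      calc _ = ∑ x, ∑ i ∈ S, ∑ y, ∑ j ∈ S, star (φ i x) * φ i y *
                ((starRingEnd ℂ) (star (φ j x)) * (starRingEnd ℂ) (φ j y)) :=
            Finset.sum_congr rfl fun x _ => Finset.sum_comm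
        _ = ∑ i ∈ S, ∑ x, ∑ j ∈ S, ∑ y, star (φ i x) * φ i y *
                ((starRingEnd ℂ) (star (φ j x)) * (starRingEnd ℂ) (φ j y)) := by
            rw [Finset.sum_comm]
            exact Finset.sum_congr rfl fun i _ => Finset.sum_congr rfl fun x _ => Finset.sum_comm
        _ = _ := by
            refine Finset.sum_congr rfl fun i _ => ?_
            rw [Finset.sum_comm]
            refine Finset.sum_congr rfl fun j _ =>
              Finset.sum_congr rfl fun x _ => Finset.sum_congr rfl fun y _ => ?_
            simp
            ring
    exact_mod_cast this
  have h3 : ∑ i ∈ S, ∑ j ∈ S, ‖star (φ i) ⬝ᵥ φ j‖ ^ 2 ≤ S.card + S.card ^ 2 * δ := by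
    calc ∑ i ∈ S, ∑ j ∈ S, ‖star (φ i) ⬝ᵥ φ j‖ ^ 2
        ≤ ∑ i ∈ S, ∑ j ∈ S, ((if i = j then 1 else 0) + δ) := by
          refine Finset.sum_le_sum fun i _ => Finset.sum_le_sum fun j _ => ?_
          by_cases hij : i = j
          · subst hij
            rw [hφ]
            simpa using hδ0
          · simpa [hij] using hδ i j hij
      _ = _ := by
        simp [Finset.sum_add_distrib, sq, mul_assoc]
  calc (S.card * θ) ^ 2 ≤ ‖∑ p : ι × ι, σ p.1 p.2 * T p.1 p.2‖ ^ 2 := by gcongr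
    _ ≤ (∑ p : ι × ι, ‖σ p.1 p.2‖ ^ 2) * ∑ p : ι × ι, ‖T p.1 p.2‖ ^ 2 := norm_sum_mul_sq_le _ _ _
    _ ≤ 1 * ∑ p : ι × ι, ‖T p.1 p.2‖ ^ 2 := by
      gcongr
      rw [Fintype.sum_prod_type]
      exact sum_norm_sq_le_one hσ htr
    _ ≤ _ := by rw [one_mul, h2]; exact h3

end Fidelity

/-! ### Partial traces -/

section PartialTrace

variable {U V W : Type} [Fintype U] [Fintype V] [Fintype W]
  [DecidableEq U] [DecidableEq V] [DecidableEq W]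

theorem extend_extend (o : V ↪ W) (a b : Bits V) (x : Bits W) :
    Function.extend o a (Function.extend o b x) = Function.extend o a x := by
  ext1 w
  by_cases hw : ∃ i, o i = w
  · obtain ⟨i, rfl⟩ := hw
    rw [o.injective.extend_apply, o.injective.extend_apply]
  · rw [Function.extend_apply' _ _ _ hw, Function.extend_apply' _ _ _ hw,
      Function.extend_apply' _ _ _ hw]

theorem extend_trans_comp (o : U ↪ V) (f : V ↪ W) (a : Bits U) (x : Bits W) :
    Function.extend (o.trans f) a x ∘ f = Function.extend o a (x ∘ f) := by
  ext1 w
  by_cases hw : ∃ i, o i = w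
  · obtain ⟨i, rfl⟩ := hw
    rw [o.injective.extend_apply]
    exact (o.trans f).injective.extend_apply _ _ i
  · rw [Function.extend_apply' _ _ _ hw]
    refine Function.extend_apply' _ _ _ ?_
    rintro ⟨i, hi⟩
    exact hw ⟨i, f.injective hi⟩

/-- The partial trace over all wires outside the range of `o`. The sum runs over the labels of these
wires, encoded as labels of all wires that vanish on the range of `o`. -/
def ptr (o : V ↪ W) (τ : Matrix (Bits W) (Bits W) ℂ) : Matrix (Bits V) (Bits V) ℂ :=
  fun a b => ∑ x : Bits W,
    if x ∘ o = 0 then τ (Function.extend o a x) (Function.extend o b x) else 0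

theorem ptr_apply_eq_sum_agreeOff (o : V ↪ W) (τ : Matrix (Bits W) (Bits W) ℂ) (a b : Bits V)
    [∀ x y, Decidable (x ∘ o = a ∧ y ∘ o = b ∧ AgreeOff o x y)] :
    ptr o τ a b = ∑ x, ∑ y, if x ∘ o = a ∧ y ∘ o = b ∧ AgreeOff o x y then τ x y else 0 := by
  have h : ∀ x y, (x ∘ o = a ∧ y ∘ o = b ∧ AgreeOff o x y) ↔
      x ∘ o = a ∧ y = Function.extend o b x := fun x y => by
    refine and_congr_right fun _ => ⟨fun h => ?_, ?_⟩
    · rw [← h.1]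
      exact agreeOff_iff_eq_extend.1 h.2
    · rintro rfl
      exact ⟨Function.extend_comp o.injective _ _, (agreeOff_extend o b x).symm⟩
  calc ptr o τ a b = ∑ x : Bits W, if x ∘ o = a then τ x (Function.extend o b x) else 0 := by
        rw [ptr, ← Finset.sum_filter, ← Finset.sum_filter]
        refine Finset.sum_nbij' (fun x => Function.extend o a x) (fun x => Function.extend o 0 x)
          ?_ ?_ ?_ ?_ ?_
        · simp [Function.extend_comp o.injective]
        · simp [Function.extend_comp o.injective]
        · intro x hx
          rw [extend_extend, ← (Finset.mem_filter.1 hx).2]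
          exact (agreeOff_iff_eq_extend.1 fun _ _ => rfl).symm
        · intro x hx
          rw [extend_extend, ← (Finset.mem_filter.1 hx).2]
          exact (agreeOff_iff_eq_extend.1 fun _ _ => rfl).symm
        · intro x _
          rw [extend_extend]
    _ = _ := by
        refine Finset.sum_congr rfl fun x _ => ?_
        rw [Finset.sum_congr rfl fun y _ => if_congr (h x y) rfl rfl]
        by_cases hx : x ∘ o = a <;> simp [hx]

theorem liftOp_conj_apply (o : V ↪ W) (M : Matrix (Bits V) (Bits V) ℂ)
    (τ : Matrix (Bits W) (Bits W) ℂ) (x y : Bits W) :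
    (liftOp o M * τ * (liftOp o M).conjTranspose) x y =
      ∑ u, ∑ v, M (x ∘ o) u * τ (Function.extend o u x) (Function.extend o v y) *
        star (M (y ∘ o) v) := by
  rw [Matrix.mul_assoc, Matrix.mul_apply, sum_liftOp_mul o M x]
  refine Finset.sum_congr rfl fun u _ => ?_
  rw [Matrix.mul_apply]
  simp only [Matrix.conjTranspose_apply]
  have := congrArg star
    (sum_liftOp_mul o M y fun z => star (τ (Function.extend o u x) z))
  simp only [star_sum, star_mul, star_star] at this
  rw [this, Finset.mul_sum]
  exact Finset.sum_congr rfl fun v _ => by ring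

theorem ptr_liftOp_conj (o : V ↪ W) (M : Matrix (Bits V) (Bits V) ℂ)
    (τ : Matrix (Bits W) (Bits W) ℂ) :
    ptr o (liftOp o M * τ * (liftOp o M).conjTranspose) = M * ptr o τ * M.conjTranspose := by
  ext a b
  simp only [ptr, liftOp_conj_apply, Function.extend_comp o.injective, extend_extend]
  rw [Matrix.mul_assoc, Matrix.mul_apply]
  simp only [Matrix.mul_apply, Matrix.conjTranspose_apply, Finset.mul_sum]
  simp only [← Finset.sum_filter, ptr, Finset.sum_mul, Finset.mul_sum]
  rw [Finset.sum_comm]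
  refine Finset.sum_congr rfl fun u _ => ?_
  rw [Finset.sum_comm]
  refine Finset.sum_congr rfl fun v _ => Finset.sum_congr rfl fun x _ => ?_
  ring

/-- An isometry that attaches a pure state `g` on the wires outside the range of `f` does not change
a partial trace in which these wires are traced out. -/
theorem ptr_isometry_conj (o : U ↪ V) (f : V ↪ W) (g : Bits W → ℂ)
    (hg : ∀ x y, AgreeOff f x y → g x = g y) (J : Matrix (Bits W) (Bits V) ℂ)
    (hJ : ∀ x y, J x y = if x ∘ f = y then g x else 0) (hJJ : J.conjTranspose * J = 1)
    (τ : Matrix (Bits V) (Bits V) ℂ) :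
    ptr (o.trans f) (J * τ * J.conjTranspose) = ptr o τ := by
  have hg' : ∀ u x, g (Function.extend (o.trans f) u x) = g x := fun u x =>
    hg _ _ (agreeOff_trans_iff.1 (agreeOff_extend (o.trans f) u x)).1
  have hnorm : ∀ y, ∑ x : Bits W, (if x ∘ f = y then g x * star (g x) else 0) = 1 := fun y => by
    have := congrFun (congrFun hJJ y) y
    rw [Matrix.mul_apply, Matrix.one_apply_eq] at this
    rw [← this]
    refine Finset.sum_congr rfl fun x _ => ?_
    by_cases h : x ∘ f = y <;> simp [hJ, h, mul_comm]
  have hconj : ∀ x y, (J * τ * J.conjTranspose) x y =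
      g x * τ (x ∘ f) (y ∘ f) * star (g y) := fun x y => by
    simp [Matrix.mul_apply, hJ, apply_ite]
  ext a b
  simp only [ptr, hconj, hg', extend_trans_comp]
  calc _ = ∑ x : Bits W, ∑ y : Bits V, if x ∘ f = y then
        (if y ∘ o = 0 then τ (Function.extend o a y) (Function.extend o b y) else 0) *
          (g x * star (g x)) else 0 := by
        refine Finset.sum_congr rfl fun x _ => ?_
        rw [Finset.sum_ite_eq, if_pos (Finset.mem_univ _)]
        have : x ∘ (o.trans f) = (x ∘ f) ∘ o := rfl
        rw [this, ite_mul, zero_mul]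
        congr 1
        ring
    _ = _ := by
        rw [Finset.sum_comm]
        refine Finset.sum_congr rfl fun y _ => ?_
        conv_rhs => rw [← mul_one (ite _ _ _), ← hnorm y, Finset.mul_sum]
        exact Finset.sum_congr rfl fun x _ => by rw [mul_ite, mul_zero]

end PartialTrace

/-! ### Local unitaries in coordinates -/

section Local

open Matrix

/-- The operator `U_A ⊗ U_B` on a register whose wires are those of Alice and those of Bob. -/
def sumKron {a b : ℕ} (UA : Matrix (Bits (Fin a)) (Bits (Fin a)) ℂ)
    (UB : Matrix (Bits (Fin b)) (Bits (Fin b)) ℂ) :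
    Matrix (Bits (Fin a ⊕ Fin b)) (Bits (Fin a ⊕ Fin b)) ℂ :=
  fun x y => UA (x ∘ Sum.inl) (y ∘ Sum.inl) * UB (x ∘ Sum.inr) (y ∘ Sum.inr)

theorem sumKron_eq_submatrix {a b : ℕ} (UA : Matrix (Bits (Fin a)) (Bits (Fin a)) ℂ)
    (UB : Matrix (Bits (Fin b)) (Bits (Fin b)) ℂ) :
    sumKron UA UB = (UA ⊗ₖ UB).submatrix (Equiv.sumArrowEquivProdArrow _ _ _)
      (Equiv.sumArrowEquivProdArrow _ _ _) := rfl

variable {a b : ℕ} (UA : unitaryGroup (Bits (Fin a)) ℂ) (UB : unitaryGroup (Bits (Fin b)) ℂ)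

theorem conjTranspose_mul_kronecker :
    ((UA : Matrix (Bits (Fin a)) (Bits (Fin a)) ℂ) ⊗ₖ
      (UB : Matrix (Bits (Fin b)) (Bits (Fin b)) ℂ))ᴴ *
    ((UA : Matrix (Bits (Fin a)) (Bits (Fin a)) ℂ) ⊗ₖ
      (UB : Matrix (Bits (Fin b)) (Bits (Fin b)) ℂ)) = 1 := by
  rw [conjTranspose_kronecker, ← mul_kronecker_mul, ← star_eq_conjTranspose,
    ← star_eq_conjTranspose, Unitary.coe_star_mul_self, Unitary.coe_star_mul_self,
    one_kronecker_one]

theorem conjTranspose_mul_sumKron :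
    (sumKron (UA : Matrix (Bits (Fin a)) (Bits (Fin a)) ℂ)
      (UB : Matrix (Bits (Fin b)) (Bits (Fin b)) ℂ))ᴴ *
    sumKron (UA : Matrix (Bits (Fin a)) (Bits (Fin a)) ℂ)
      (UB : Matrix (Bits (Fin b)) (Bits (Fin b)) ℂ) = 1 := by
  rw [sumKron_eq_submatrix, conjTranspose_submatrix, submatrix_mul_equiv,
    conjTranspose_mul_kronecker, submatrix_one_equiv]

theorem localConj_inv_localConj (ρ : BiOp a b) :
    localConj UA⁻¹ UB⁻¹ (localConj UA UB ρ) = ρ := by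
  have h : ((UA⁻¹ : unitaryGroup (Bits (Fin a)) ℂ) : Matrix (Bits (Fin a)) (Bits (Fin a)) ℂ) ⊗ₖ
      ((UB⁻¹ : unitaryGroup (Bits (Fin b)) ℂ) : Matrix (Bits (Fin b)) (Bits (Fin b)) ℂ) =
      ((UA : Matrix (Bits (Fin a)) (Bits (Fin a)) ℂ) ⊗ₖ
      (UB : Matrix (Bits (Fin b)) (Bits (Fin b)) ℂ))ᴴ := by
    rw [conjTranspose_kronecker]; rfl
  have h1 := conjTranspose_mul_kronecker UA UB
  rw [localConj, localConj, h, conjTranspose_conjTranspose]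
  simp only [Matrix.mul_assoc, h1, Matrix.mul_one]
  rw [← Matrix.mul_assoc, h1, Matrix.one_mul]

theorem fidelity_localConj (ρ σ : BiOp a b) :
    fidelity (localConj UA UB ρ) (localConj UA UB σ) = fidelity ρ σ :=
  fidelity_unitary_conj (conjTranspose_mul_kronecker UA UB) ρ σ

theorem localConj_submatrix (M : Matrix (Bits (Fin a ⊕ Fin b)) (Bits (Fin a ⊕ Fin b)) ℂ) :
    localConj UA UB (M.submatrix (Equiv.sumArrowEquivProdArrow _ _ _).symm
      (Equiv.sumArrowEquivProdArrow _ _ _).symm) =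
    (sumKron (UA : Matrix (Bits (Fin a)) (Bits (Fin a)) ℂ)
      (UB : Matrix (Bits (Fin b)) (Bits (Fin b)) ℂ) * M *
      (sumKron (UA : Matrix (Bits (Fin a)) (Bits (Fin a)) ℂ)
      (UB : Matrix (Bits (Fin b)) (Bits (Fin b)) ℂ))ᴴ).submatrix
      (Equiv.sumArrowEquivProdArrow _ _ _).symm (Equiv.sumArrowEquivProdArrow _ _ _).symm := by
  rw [← submatrix_mul_equiv _ _ _ (Equiv.sumArrowEquivProdArrow _ _ _).symm,
    ← submatrix_mul_equiv _ _ _ (Equiv.sumArrowEquivProdArrow _ _ _).symm]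
  rfl

variable {G : Set Gate} {t : ℕ} {C : Circuit G (Fin a ⊕ (Fin b ⊕ Fin t))} {UA UB}

theorem padAncilla_single (u : Bits (Fin a)) (v : Bits (Fin b)) :
    padAncilla t (Pi.single (u, v) 1) = Pi.single (Sum.elim u (Sum.elim v 0)) 1 := by
  ext x
  simp only [padAncilla, Pi.single_apply]
  rw [← ite_and]
  congr 1
  rw [eq_iff_iff]
  constructor
  · rintro ⟨h, h'⟩
    rw [Prod.mk.injEq] at h'
    ext1 w
    rcases w with i | i | i
    · exact congrFun h'.1 i
    · exact congrFun h'.2 i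
    · exact h i
  · rintro rfl
    exact ⟨fun _ => rfl, rfl⟩

/-- The columns of the circuit whose ancillas are zero. The phase `z` drops out of the channels, so
that it has modulus one is not recorded. -/
theorem ImplementsLocal.apply_zero (h : ImplementsLocal C UA UB) :
    ∃ z : ℂ, ∀ (x : Bits (Fin a ⊕ (Fin b ⊕ Fin t))) (u : Bits (Fin a)) (v : Bits (Fin b)),
      circuitMatrix C x (Sum.elim u (Sum.elim v 0)) =
        if ∀ i : Fin t, x (Sum.inr (Sum.inr i)) = 0 then
          z * ((UA : Matrix (Bits (Fin a)) (Bits (Fin a)) ℂ) (x ∘ Sum.inl) u *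
            (UB : Matrix (Bits (Fin b)) (Bits (Fin b)) ℂ) (x ∘ Sum.inr ∘ Sum.inl) v) else 0 := by
  obtain ⟨z, -, hz⟩ := h
  refine ⟨z, fun x u v => ?_⟩
  have := congrFun (hz (Pi.single (u, v) 1)) x
  rw [padAncilla_single, mulVec_single_one, mulVec_single_one] at this
  refine this.trans ?_
  simp only [Pi.smul_apply, padAncilla, smul_eq_mul, mul_ite, mul_zero]
  rfl

/-- The reversed circuit implements the inverse local unitary. -/
theorem ImplementsLocal.inv (h : ImplementsLocal C UA UB)
    {D : Circuit G (Fin a ⊕ (Fin b ⊕ Fin t))}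
    (hD : circuitMatrix D = (circuitMatrix C)ᴴ) : ImplementsLocal D UA⁻¹ UB⁻¹ := by
  obtain ⟨z, hz1, hz⟩ := h
  have hzz : star z * z = 1 := by
    rw [Complex.star_def, Complex.conj_mul', hz1]; simp
  refine ⟨star z, by rwa [norm_star], fun ψ => ?_⟩
  set K := (UA : Matrix (Bits (Fin a)) (Bits (Fin a)) ℂ) ⊗ₖ
      (UB : Matrix (Bits (Fin b)) (Bits (Fin b)) ℂ) with hK
  have hK' : ((UA⁻¹ : unitaryGroup (Bits (Fin a)) ℂ) : Matrix (Bits (Fin a)) (Bits (Fin a)) ℂ) ⊗ₖ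
      ((UB⁻¹ : unitaryGroup (Bits (Fin b)) ℂ) : Matrix (Bits (Fin b)) (Bits (Fin b)) ℂ) = Kᴴ := by
    rw [hK, conjTranspose_kronecker]; rfl
  have hKK : K * Kᴴ = 1 := mul_eq_one_comm.1 (conjTranspose_mul_kronecker UA UB)
  have h1 := hz (Kᴴ *ᵥ ψ)
  rw [mulVec_mulVec, hKK, one_mulVec] at h1
  have h2 := congrArg ((circuitMatrix C)ᴴ *ᵥ ·) h1
  simp only [mulVec_mulVec, conjTranspose_mul_circuitMatrix, one_mulVec, mulVec_smul] at h2
  rw [hD, hK', h2, smul_smul, hzz, one_smul]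

end Local

/-! ### Appending a local unitary to an LOCC circuit -/

namespace LOCCCircuit

open Matrix

variable {G : Set Gate} {kA kB mA mB : ℕ} (P : LOCCCircuit G kA kB mA mB)

/-- The wires of the output. -/
def outWires : Fin mA ⊕ Fin mB ↪ P.Wires :=
  (Fin.castLEEmb P.outA).sumMap ((Fin.castLEEmb P.outB).trans Function.Embedding.inr)

theorem agreeOffOutput_iff (x y : Bits P.Wires) :
    P.AgreeOffOutput x y ↔ AgreeOff P.outWires x y := by
  constructor
  · rintro ⟨hA, hq, hB⟩ (i | i | i) hw
    · refine hA i (not_lt.1 fun hi => hw (Sum.inl ⟨i, hi⟩) rfl)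
    · exact hq i
    · refine hB i (not_lt.1 fun hi => hw (Sum.inr ⟨i, hi⟩) rfl)
  · intro h
    refine ⟨fun i hi => h _ ?_, fun i => h _ ?_, fun i hi => h _ ?_⟩
    · rintro (j | j) hj
      · have : (j : ℕ) = i := congrArg Fin.val (Sum.inl_injective hj)
        have := j.2
        omega
      · cases hj
    · rintro (j | j) hj <;> cases hj
    · rintro (j | j) hj
      · cases hj
      · have : (j : ℕ) = i := congrArg Fin.val (Sum.inr_injective (Sum.inr_injective hj))
        have := j.2
        omega

/-- The partial trace `discard` in the form `ptr`, with pairs of labels in place of labels of the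
disjoint union of the output wires. -/
theorem discard_eq_ptr (τ : P.Op) :
    P.discard τ = (ptr P.outWires τ).submatrix (Equiv.sumArrowEquivProdArrow _ _ _).symm
      (Equiv.sumArrowEquivProdArrow _ _ _).symm := by
  ext a b
  have h : ∀ (x : Bits P.Wires) (c : BiBits mA mB), P.outputBits x = c ↔
      x ∘ P.outWires = (Equiv.sumArrowEquivProdArrow _ _ _).symm c := fun x c => by
    rw [Equiv.eq_symm_apply]
    rfl
  classical
  rw [submatrix_apply, ptr_apply_eq_sum_agreeOff]
  refine Finset.sum_congr rfl fun x _ => Finset.sum_congr rfl fun y _ => if_congr ?_ rfl rfl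
  rw [h, h, agreeOffOutput_iff]

theorem trace_discard (τ : P.Op) : (P.discard τ).trace = τ.trace := by
  have h : ∀ x y, (P.outputBits x = P.outputBits y ∧ P.AgreeOffOutput x y) ↔ x = y := fun x y => by
    constructor
    · rintro ⟨h, h'⟩
      refine ((P.agreeOffOutput_iff x y).1 h').eq ?_
      ext1 (i | i)
      · exact congrFun (congrArg Prod.fst h) i
      · exact congrFun (congrArg Prod.snd h) i
    · rintro rfl
      exact ⟨rfl, (P.agreeOffOutput_iff x x).2 fun _ _ => rfl⟩
  simp only [trace, diag_apply, discard]
  rw [Finset.sum_comm]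
  refine Finset.sum_congr rfl fun x _ => ?_
  rw [Finset.sum_comm]
  calc _ = ∑ y, if x = y then τ x y else 0 := by
        refine Finset.sum_congr rfl fun y _ => ?_
        simp only [ite_and, Finset.sum_ite_eq, Finset.mem_univ, if_true, ← h]
        split_ifs <;> simp_all
    _ = _ := by simp

theorem discard_measure (τ : P.Op) : P.discard (P.measure τ) = P.discard τ := by
  ext a b
  simp only [discard]
  refine Finset.sum_congr rfl fun x _ => Finset.sum_congr rfl fun y _ => ?_
  split_ifs with h
  · rw [measure, if_pos h.2.2.2.1]
  · rfl

theorem discard_liftOp_conj (UA : unitaryGroup (Bits (Fin mA)) ℂ)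
    (UB : unitaryGroup (Bits (Fin mB)) ℂ) (τ : P.Op) :
    P.discard (liftOp P.outWires (sumKron (UA : Matrix (Bits (Fin mA)) (Bits (Fin mA)) ℂ)
      (UB : Matrix (Bits (Fin mB)) (Bits (Fin mB)) ℂ)) * τ *
      (liftOp P.outWires (sumKron (UA : Matrix (Bits (Fin mA)) (Bits (Fin mA)) ℂ)
      (UB : Matrix (Bits (Fin mB)) (Bits (Fin mB)) ℂ)))ᴴ) = localConj UA UB (P.discard τ) := by
  rw [discard_eq_ptr, discard_eq_ptr, ptr_liftOp_conj, localConj_submatrix]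

/-- The measurement of the register commutes with operations on the other wires. -/
theorem measure_liftOp_conj {V : Type} [Fintype V] [DecidableEq V] (f : V ↪ P.Wires)
    (hf : ∀ v i, f v ≠ Sum.inr (Sum.inl i)) (M : Matrix (Bits V) (Bits V) ℂ) (τ : P.Op) :
    P.measure (liftOp f M * τ * (liftOp f M)ᴴ) = liftOp f M * P.measure τ * (liftOp f M)ᴴ := by
  ext x y
  have h : ∀ (u : Bits V) (x : Bits P.Wires) i,
      Function.extend f u x (Sum.inr (Sum.inl i)) = x (Sum.inr (Sum.inl i)) := fun u x i =>
    Function.extend_apply' _ _ _ fun ⟨v, hv⟩ => hf v i hv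
  simp only [measure, liftOp_conj_apply, h]
  split_ifs <;> simp

variable {t : ℕ} (C : Circuit G (Fin mA ⊕ (Fin mB ⊕ Fin t)))

/-- Alice's wires for a circuit on the output, Bob's part of it being replaced by ancillas. -/
def aliceLocal : Fin mA ⊕ (Fin mB ⊕ Fin t) ↪ Fin (kA + (P.tA + (mB + t))) ⊕ Fin P.q :=
  Function.Embedding.trans
    ⟨Sum.elim (Fin.castLE (P.outA.trans (by omega)))
      fun s => Fin.natAdd kA (Fin.natAdd P.tA (finSumFinEquiv s)), by
        refine (Fin.castLE_injective _).sumElim ?_ ?_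
        · exact (Fin.natAdd_injective _ _).comp
            ((Fin.natAdd_injective _ _).comp finSumFinEquiv.injective)
        · intro i s h
          have := congrArg Fin.val h
          have := i.2
          have := P.outA
          simp at *
          omega⟩ Function.Embedding.inl

/-- Bob's wires for a circuit on the output, Alice's part of it being replaced by ancillas. -/
def bobLocal : Fin mA ⊕ (Fin mB ⊕ Fin t) ↪ Fin (kB + (P.tB + (mA + t))) ⊕ Fin P.q :=
  Function.Embedding.trans
    ⟨Sum.elim (fun i => Fin.natAdd kB (Fin.natAdd P.tB (Fin.castAdd t i)))
      (Sum.elim (Fin.castLE (P.outB.trans (by omega)))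
        fun i => Fin.natAdd kB (Fin.natAdd P.tB (Fin.natAdd mA i))), by
        have hB := P.outB
        rintro (i | i | i) (j | j | j) h <;> have := congrArg Fin.val h <;> have := i.2 <;>
          have := j.2 <;> simp [Fin.ext_iff] at * <;> omega⟩ Function.Embedding.inl

/-- Alice's wires as wires of `appendLocal`. -/
def aliceOld (t : ℕ) : Fin (kA + P.tA) ⊕ Fin P.q ↪ Fin (kA + (P.tA + (mB + t))) ⊕ Fin P.q :=
  (Fin.castLEEmb (by omega)).sumMap (Function.Embedding.refl _)

/-- Bob's wires as wires of `appendLocal`. -/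
def bobOld (t : ℕ) : Fin (kB + P.tB) ⊕ Fin P.q ↪ Fin (kB + (P.tB + (mA + t))) ⊕ Fin P.q :=
  (Fin.castLEEmb (by omega)).sumMap (Function.Embedding.refl _)

/-- The LOCC circuit `P` followed by one round in which Alice and Bob each run the circuit `C`, with
fresh ancillas in place of the qubits of the other party. -/
abbrev appendLocal : LOCCCircuit G kA kB mA mB where
  tA := P.tA + (mB + t)
  tB := P.tB + (mA + t)
  q := P.q
  rounds := P.rounds.map (fun R => (R.1.map (PlacedGate.map (P.aliceOld t)),
      R.2.map (PlacedGate.map (P.bobOld t)))) ++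
    [(C.map (PlacedGate.map P.aliceLocal), C.map (PlacedGate.map P.bobLocal))]
  outA := P.outA.trans (by omega)
  outB := P.outB.trans (by omega)

theorem size_appendLocal :
    (P.appendLocal C).size = P.size + (mA + mB) + 2 * (C.length + t) + 2 * P.q := by
  have : ∀ l : List (Circuit G (Fin (kA + P.tA) ⊕ Fin P.q) × Circuit G (Fin (kB + P.tB) ⊕ Fin P.q)),
      ((l.map (fun R => (R.1.map (PlacedGate.map (P.aliceOld t)),
        R.2.map (PlacedGate.map (P.bobOld t))))).map
          fun R => R.1.length + R.2.length + 2 * P.q) =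
      l.map fun R => R.1.length + R.2.length + 2 * P.q := fun l => by
    simp
  simp only [size, appendLocal, List.map_append, List.sum_append, this]
  simp
  ring

/-- The wires of `P` as wires of `appendLocal`. -/
def oldWires : P.Wires ↪ (P.appendLocal C).Wires :=
  Function.Embedding.sumMap (Fin.castLEEmb (by simp only; omega))
    (Function.Embedding.sumMap (Function.Embedding.refl _)
      (Fin.castLEEmb (by simp only; omega)))

theorem initial_appendLocal (σ : BiOp kA kB) :
    (P.appendLocal C).initial σ =
      padOp (P.oldWires C) * P.initial σ * (padOp (P.oldWires C))ᴴ := by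
  classical
  have h : ∀ x : Bits (P.appendLocal C).Wires, (P.appendLocal C).AncillaZero x ↔
      AgreeOff (P.oldWires C) x 0 ∧ P.AncillaZero (x ∘ P.oldWires C) := fun x => by
    constructor
    · rintro ⟨hA, hq, hB⟩
      refine ⟨?_, fun i => hA (Fin.castAdd _ i), hq, fun i => hB (Fin.castAdd _ i)⟩
      rintro (i | i | i) hw
      · have hi : kA ≤ i := le_of_not_gt fun hi => hw (Sum.inl ⟨i, by omega⟩) rfl
        have := hA ⟨i - kA, by omega⟩
        rwa [show Fin.natAdd kA _ = i from Fin.ext (by simp; omega)] at this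
      · exact hq i
      · have hi : kB ≤ i := le_of_not_gt fun hi => hw (Sum.inr (Sum.inr ⟨i, by omega⟩)) rfl
        have := hB ⟨i - kB, by omega⟩
        rwa [show Fin.natAdd kB _ = i from Fin.ext (by simp; omega)] at this
    · rintro ⟨h0, hA, hq, hB⟩
      refine ⟨fun i => ?_, hq, fun i => ?_⟩
      · by_cases hi : (i : ℕ) < P.tA
        · exact hA ⟨i, hi⟩
        · refine h0 _ ?_
          rintro (j | j | j) hj
          · have := congrArg Fin.val (Sum.inl_injective hj)
            have := j.2
            simp at *
            omega
          · cases hj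
          · cases hj
      · by_cases hi : (i : ℕ) < P.tB
        · exact hB ⟨i, hi⟩
        · refine h0 _ ?_
          rintro (j | j | j) hj
          · cases hj
          · cases hj
          · have := congrArg Fin.val (Sum.inr_injective (Sum.inr_injective hj))
            have := j.2
            simp at *
            omega
  ext x y
  rw [padOp_conj_apply]
  simp only [initial, h, ← ite_and]
  refine if_congr (by tauto) rfl rfl

theorem measure_appendLocal (τ : P.Op) :
    (P.appendLocal C).measure (padOp (P.oldWires C) * τ * (padOp (P.oldWires C))ᴴ) =
      padOp (P.oldWires C) * P.measure τ * (padOp (P.oldWires C))ᴴ := by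
  classical
  ext x y
  simp only [measure, padOp_conj_apply]
  have : (∀ i : Fin P.q, x (Sum.inr (Sum.inl i)) = y (Sum.inr (Sum.inl i))) ↔
    ∀ i : Fin P.q, (x ∘ P.oldWires C) (Sum.inr (Sum.inl i)) =
      (y ∘ P.oldWires C) (Sum.inr (Sum.inl i)) := Iff.rfl
  by_cases h : ∀ i : Fin P.q, x (Sum.inr (Sum.inl i)) = y (Sum.inr (Sum.inl i))
  · rw [if_pos (this.1 h)]
    exact if_pos h
  · rw [if_neg (mt this.2 h), ite_self]
    exact if_neg h

theorem applyCircuit_appendLocal (D : Circuit G P.Wires) (τ : P.Op) :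
    (P.appendLocal C).applyCircuit (D.map (PlacedGate.map (P.oldWires C)))
      (padOp (P.oldWires C) * τ * (padOp (P.oldWires C))ᴴ) =
    padOp (P.oldWires C) * P.applyCircuit D τ * (padOp (P.oldWires C))ᴴ := by
  have h := liftOp_mul_padOp (P.oldWires C) (circuitMatrix D)
  have h' := congrArg conjTranspose h
  rw [conjTranspose_mul, conjTranspose_mul] at h'
  rw [applyCircuit, applyCircuit, circuitMatrix_map]
  calc _ = (liftOp (P.oldWires C) (circuitMatrix D) * padOp (P.oldWires C)) * τ *
        ((padOp (P.oldWires C))ᴴ * (liftOp (P.oldWires C) (circuitMatrix D))ᴴ) := by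
        simp only [Matrix.mul_assoc]
    _ = _ := by
      rw [h, h']
      simp only [Matrix.mul_assoc]

theorem round_appendLocal
    (R : Circuit G (Fin (kA + P.tA) ⊕ Fin P.q) × Circuit G (Fin (kB + P.tB) ⊕ Fin P.q))
    (τ : P.Op) :
    (P.appendLocal C).round (padOp (P.oldWires C) * τ * (padOp (P.oldWires C))ᴴ)
      (R.1.map (PlacedGate.map (P.aliceOld t)), R.2.map (PlacedGate.map (P.bobOld t))) =
    padOp (P.oldWires C) * P.round τ R * (padOp (P.oldWires C))ᴴ := by
  have hA : (R.1.map (PlacedGate.map (P.aliceOld t))).map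
      (PlacedGate.map (P.appendLocal C).aliceWires) =
      (R.1.map (PlacedGate.map P.aliceWires)).map (PlacedGate.map (P.oldWires C)) := by
    rw [List.map_map, List.map_map]
    refine List.map_congr_left fun g _ => ?_
    simp only [Function.comp, PlacedGate.map]
    congr 1
    ext i
    rcases h : g.wires i with j | j <;> simp [h, aliceOld, aliceWires, oldWires]
  have hB : (R.2.map (PlacedGate.map (P.bobOld t))).map
      (PlacedGate.map (P.appendLocal C).bobWires) =
      (R.2.map (PlacedGate.map P.bobWires)).map (PlacedGate.map (P.oldWires C)) := by
    rw [List.map_map, List.map_map]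
    refine List.map_congr_left fun g _ => ?_
    simp only [Function.comp, PlacedGate.map]
    congr 1
    ext i
    rcases h : g.wires i with j | j <;> simp [h, bobOld, bobWires, oldWires] <;> rfl
  simp only [round]
  rw [← measure_appendLocal, ← applyCircuit_appendLocal, ← measure_appendLocal,
    ← applyCircuit_appendLocal, ← hA, ← hB]

theorem foldl_round_appendLocal
    (l : List (Circuit G (Fin (kA + P.tA) ⊕ Fin P.q) × Circuit G (Fin (kB + P.tB) ⊕ Fin P.q)))
    (τ : P.Op) :
    (l.map (fun R => (R.1.map (PlacedGate.map (P.aliceOld t)),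
        R.2.map (PlacedGate.map (P.bobOld t))))).foldl (P.appendLocal C).round
      (padOp (P.oldWires C) * τ * (padOp (P.oldWires C))ᴴ) =
    padOp (P.oldWires C) * l.foldl P.round τ * (padOp (P.oldWires C))ᴴ := by
  induction l generalizing τ with
  | nil => rfl
  | cons R l ih => rw [List.map_cons, List.foldl_cons, List.foldl_cons, ← ih, round_appendLocal]

variable {C} {UA : unitaryGroup (Bits (Fin mA)) ℂ} {UB : unitaryGroup (Bits (Fin mB)) ℂ}

/-- On the output of `P`, the last round of `appendLocal` is `U_A ⊗ U_B` after an isometry that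
attaches a pure state on the fresh ancillas. -/
theorem exists_isometry_appendLocal (h : ImplementsLocal C UA UB) :
    ∃ J : Matrix (Bits (P.appendLocal C).Wires) (Bits P.Wires) ℂ,
      liftOp (P.bobLocal.trans (P.appendLocal C).bobWires) (circuitMatrix C) *
        (liftOp (P.aliceLocal.trans (P.appendLocal C).aliceWires) (circuitMatrix C) *
          padOp (P.oldWires C)) =
      liftOp (P.appendLocal C).outWires (sumKron (UA : Matrix (Bits (Fin mA)) (Bits (Fin mA)) ℂ)
        (UB : Matrix (Bits (Fin mB)) (Bits (Fin mB)) ℂ)) * J ∧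
      ∀ τ : P.Op, ptr (P.appendLocal C).outWires (J * τ * Jᴴ) = ptr P.outWires τ := by
  classical
  obtain ⟨z, hz⟩ := h.apply_zero
  set f := P.oldWires C with hf
  set jA := P.aliceLocal.trans (P.appendLocal C).aliceWires with hjA
  set jB := P.bobLocal.trans (P.appendLocal C).bobWires with hjB
  have hout : (P.appendLocal C).outWires = P.outWires.trans f := by
    ext (i | i) <;> rfl
  have hB1 : ∀ i, jB (Sum.inl i) =
      Sum.inr (Sum.inr (Fin.natAdd kB (Fin.natAdd P.tB (Fin.castAdd t i)))) := fun i => rfl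
  have hB2 : ∀ i, jB (Sum.inr (Sum.inr i)) =
      Sum.inr (Sum.inr (Fin.natAdd kB (Fin.natAdd P.tB (Fin.natAdd mA i)))) := fun i => rfl
  -- none of the fresh ancillas is an old wire
  have hfA : ∀ w s, f w ≠ jA (Sum.inr s) := by
    rintro (i | i | i) s h
    · have := congrArg Fin.val (Sum.inl_injective h)
      have := i.2
      simp at *
      omega
    · cases h
    · cases h
  have hfB : ∀ w s, f w ≠ jB (Sum.inl s) := by
    rintro (i | i | i) s h
    · cases h
    · cases h
    · rw [hB1] at h
      have := congrArg Fin.val (Sum.inr_injective (Sum.inr_injective h))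
      have := i.2
      simp at *
      omega
  have hfB' : ∀ w s, f w ≠ jB (Sum.inr (Sum.inr s)) := by
    rintro (i | i | i) s h
    · cases h
    · cases h
    · rw [hB2] at h
      have := congrArg Fin.val (Sum.inr_injective (Sum.inr_injective h))
      have := i.2
      simp at *
      omega
  have hoA : ∀ i, jA (Sum.inl i) = f (P.outWires (Sum.inl i)) := fun i => rfl
  have hoB : ∀ i, jB (Sum.inr (Sum.inl i)) = f (P.outWires (Sum.inr i)) := fun i => rfl
  have hdisj : ∀ i j, jB i ≠ jA j := by
    rintro (i | i | i) j h <;> cases h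
  -- the state of the fresh ancillas: `U_A |0⟩` on Bob's side and `U_B |0⟩` on Alice's side
  let g : Bits (P.appendLocal C).Wires → ℂ := fun x =>
    (if ∀ i : Fin t, x (jB (Sum.inr (Sum.inr i))) = 0 then
      z * (UA : Matrix (Bits (Fin mA)) (Bits (Fin mA)) ℂ) (x ∘ jB ∘ Sum.inl) 0 else 0) *
    (if ∀ i : Fin t, x (jA (Sum.inr (Sum.inr i))) = 0 then
      z * (UB : Matrix (Bits (Fin mB)) (Bits (Fin mB)) ℂ) (x ∘ jA ∘ Sum.inr ∘ Sum.inl) 0 else 0)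
  have hg : ∀ x y, AgreeOff f x y → g x = g y := fun x y hxy => by
    have h1 : ∀ i, x (jB (Sum.inl i)) = y (jB (Sum.inl i)) := fun i => hxy _ fun w => hfB w i
    have h2 : ∀ i, x (jB (Sum.inr (Sum.inr i))) = y (jB (Sum.inr (Sum.inr i))) := fun i =>
      hxy _ fun w => hfB' w i
    have h3 : ∀ i, x (jA (Sum.inr i)) = y (jA (Sum.inr i)) := fun i => hxy _ fun w => hfA w i
    have h4 : x ∘ jB ∘ Sum.inl = y ∘ jB ∘ Sum.inl := funext h1
    have h5 : x ∘ jA ∘ Sum.inr ∘ Sum.inl = y ∘ jA ∘ Sum.inr ∘ Sum.inl := funext fun i => h3 _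
    simp only [g, h2, h3, h4, h5]
  let J : Matrix (Bits (P.appendLocal C).Wires) (Bits P.Wires) ℂ := fun x y =>
    if x ∘ f = y then g x else 0
  have hK : liftOp jB (circuitMatrix C) * (liftOp jA (circuitMatrix C) * padOp f) =
      liftOp (P.appendLocal C).outWires (sumKron (UA : Matrix (Bits (Fin mA)) (Bits (Fin mA)) ℂ)
        (UB : Matrix (Bits (Fin mB)) (Bits (Fin mB)) ℂ)) * J := by
    ext x y
    rw [← Matrix.mul_assoc, mul_padOp_apply, liftOp_mul_liftOp_apply hdisj, Matrix.mul_apply,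
      sum_liftOp_mul (P.appendLocal C).outWires _ x fun w => J w y]
    have hyA : Function.extend f y 0 ∘ jA =
        Sum.elim (y ∘ P.outWires ∘ Sum.inl) (Sum.elim 0 0) := by
      ext1 w
      rcases w with i | i | i
      · exact f.injective.extend_apply y _ (P.outWires (Sum.inl i))
      · exact Function.extend_apply' y (0 : Bits (P.appendLocal C).Wires) _
          fun ⟨w, hw⟩ => hfA w _ hw
      · exact Function.extend_apply' y (0 : Bits (P.appendLocal C).Wires) _
          fun ⟨w, hw⟩ => hfA w _ hw
    have hyB : Function.extend f y 0 ∘ jB =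
        Sum.elim (0 : Bits (Fin mA)) (Sum.elim (y ∘ P.outWires ∘ Sum.inr) 0) := by
      ext1 w
      rcases w with i | i | i
      · exact Function.extend_apply' y (0 : Bits (P.appendLocal C).Wires) _
          fun ⟨w, hw⟩ => hfB w _ hw
      · exact f.injective.extend_apply y _ (P.outWires (Sum.inr i))
      · exact Function.extend_apply' y (0 : Bits (P.appendLocal C).Wires) _
          fun ⟨w, hw⟩ => hfB' w _ hw
    -- every fresh ancilla is a wire of one of the two copies of `C`
    have hiff : (∀ w, (∀ i, jB i ≠ w) → (∀ j, jA j ≠ w) → x w = Function.extend f y 0 w) ↔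
        AgreeOff P.outWires (x ∘ f) y := by
      constructor
      · intro h w hw
        have := h (f w) ?_ ?_
        · rwa [f.injective.extend_apply] at this
        · rintro (i | i | i) hi
          · exact hfB _ _ hi.symm
          · exact hw (Sum.inr i) (f.injective hi)
          · exact hfB' _ _ hi.symm
        · rintro (i | i) hi
          · exact hw (Sum.inl i) (f.injective hi)
          · exact hfA _ _ hi.symm
      · intro h w hB hA
        have hw : ∃ w', f w' = w := by
          rcases w with i | i | i
          · have hi2 : (i : ℕ) < kA + (P.tA + (mB + t)) := i.2
            by_cases hi : (i : ℕ) < kA + P.tA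
            · exact ⟨Sum.inl ⟨i, hi⟩, rfl⟩
            · refine (hA (Sum.inr (finSumFinEquiv.symm ⟨i - (kA + P.tA), by omega⟩)) ?_).elim
              refine congrArg Sum.inl (Fin.ext ?_)
              simp
              omega
          · exact ⟨Sum.inr (Sum.inl i), rfl⟩
          · have hi2 : (i : ℕ) < kB + (P.tB + (mA + t)) := i.2
            by_cases hi : (i : ℕ) < kB + P.tB
            · exact ⟨Sum.inr (Sum.inr ⟨i, hi⟩), rfl⟩
            · by_cases hi' : (i : ℕ) < kB + P.tB + mA
              · refine (hB (Sum.inl ⟨i - (kB + P.tB), by omega⟩) ?_).elim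
                rw [hB1]
                refine congrArg (Sum.inr ∘ Sum.inr) (Fin.ext ?_)
                simp
                omega
              · refine (hB (Sum.inr (Sum.inr ⟨i - (kB + P.tB + mA), by omega⟩)) ?_).elim
                rw [hB2]
                refine congrArg (Sum.inr ∘ Sum.inr) (Fin.ext ?_)
                simp
                omega
        obtain ⟨w, rfl⟩ := hw
        rw [f.injective.extend_apply]
        refine h w fun i hi => ?_
        rcases i with i | i
        · exact hA (Sum.inl i) (by rw [hoA, hi])
        · exact hB (Sum.inr (Sum.inl i)) (by rw [hoB, hi])
    have hJ : ∀ u, J (Function.extend (P.appendLocal C).outWires u x) y =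
        if u = y ∘ P.outWires ∧ AgreeOff P.outWires (x ∘ f) y then g x else 0 := fun u => by
      have e : g (Function.extend (P.appendLocal C).outWires u x) = g x := by
        rw [hout]
        exact hg _ _ (agreeOff_trans_iff.1 (agreeOff_extend (P.outWires.trans f) u x)).1
      simp only [J, e]
      refine if_congr ?_ rfl rfl
      rw [hout, extend_trans_comp]
      constructor
      · rintro rfl
        exact ⟨(Function.extend_comp P.outWires.injective _ _).symm,
          (agreeOff_extend P.outWires u _).symm⟩
      · rintro ⟨rfl, h⟩
        exact (agreeOff_iff_eq_extend.1 h).symm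
    simp only [hJ, hiff, hyA, hyB, hz]
    by_cases hxy : AgreeOff P.outWires (x ∘ f) y
    · simp only [hxy, and_true, mul_ite, mul_zero, Finset.sum_ite_eq', Finset.mem_univ, if_true,
        sumKron, g, Function.comp_apply]
      have e1 : (x ∘ jB) ∘ Sum.inl = x ∘ jB ∘ Sum.inl := rfl
      have e2 : (x ∘ jB) ∘ Sum.inr ∘ Sum.inl = (x ∘ (P.appendLocal C).outWires) ∘ Sum.inr := rfl
      have e3 : (x ∘ jA) ∘ Sum.inl = (x ∘ (P.appendLocal C).outWires) ∘ Sum.inl := rfl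
      have e4 : (x ∘ jA) ∘ Sum.inr ∘ Sum.inl = x ∘ jA ∘ Sum.inr ∘ Sum.inl := rfl
      have e5 : y ∘ P.outWires ∘ Sum.inl = (y ∘ P.outWires) ∘ Sum.inl := rfl
      have e6 : y ∘ P.outWires ∘ Sum.inr = (y ∘ P.outWires) ∘ Sum.inr := rfl
      rw [e1, e2, e3, e4, e5, e6]
      split_ifs <;> ring
    · simp [hxy]
  refine ⟨J, hK, fun τ => ?_⟩
  rw [hout]
  refine ptr_isometry_conj P.outWires f g hg J (fun _ _ => rfl) ?_ τ
  have hC : ∀ {V : Type} [Fintype V] [DecidableEq V] (i : V ↪ (P.appendLocal C).Wires)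
      {M : Matrix (Bits V) (Bits V) ℂ}, Mᴴ * M = 1 → (liftOp i M)ᴴ * liftOp i M = 1 :=
    fun i M hM => by rw [← liftOp_conjTranspose, ← liftOp_mul, hM, liftOp_one]
  have h1 := hC (P.appendLocal C).outWires (conjTranspose_mul_sumKron UA UB)
  have h2 := hC jA (conjTranspose_mul_circuitMatrix C)
  have h3 := hC jB (conjTranspose_mul_circuitMatrix C)
  have h4 := conjTranspose_padOp_mul_padOp f
  -- `J` is an isometry because all other factors of `hK` are
  have h5 := congrArg (fun K => Kᴴ * K) hK
  simp only [conjTranspose_mul, Matrix.mul_assoc] at h5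
  rw [← Matrix.mul_assoc _ (liftOp jB _), h3, Matrix.one_mul, ← Matrix.mul_assoc _ (liftOp jA _),
    h2, Matrix.one_mul, h4, ← Matrix.mul_assoc _ (liftOp (P.appendLocal C).outWires _), h1,
    Matrix.one_mul] at h5
  exact h5.symm

theorem channel_appendLocal (h : ImplementsLocal C UA UB) (σ : BiOp kA kB) :
    (P.appendLocal C).channel σ = localConj UA UB (P.channel σ) := by
  obtain ⟨J, hK, hJ⟩ := P.exists_isometry_appendLocal h
  set τ := P.rounds.foldl P.round (P.initial σ) with hτ
  have hmeas := (P.appendLocal C).measure_liftOp_conj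
    (P.bobLocal.trans (P.appendLocal C).bobWires) (by rintro (_ | _ | _) _ h <;> cases h)
    (circuitMatrix C)
  -- `τ` with fresh ancillas is the state before the last round
  have h1 : (P.appendLocal C).channel σ = (P.appendLocal C).discard
      ((P.appendLocal C).round (padOp (P.oldWires C) * τ * (padOp (P.oldWires C))ᴴ)
        (C.map (PlacedGate.map P.aliceLocal), C.map (PlacedGate.map P.bobLocal))) := by
    rw [channel, initial_appendLocal, hτ, ← foldl_round_appendLocal]
    exact congrArg _ List.foldl_append
  have hA : (C.map (PlacedGate.map P.aliceLocal)).map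
      (PlacedGate.map (P.appendLocal C).aliceWires) =
      C.map (PlacedGate.map (P.aliceLocal.trans (P.appendLocal C).aliceWires)) := by
    rw [List.map_map]
    rfl
  have hB : (C.map (PlacedGate.map P.bobLocal)).map
      (PlacedGate.map (P.appendLocal C).bobWires) =
      C.map (PlacedGate.map (P.bobLocal.trans (P.appendLocal C).bobWires)) := by
    rw [List.map_map]
    rfl
  rw [h1, round, discard_measure]
  simp only [applyCircuit]
  rw [hA, hB, circuitMatrix_map, circuitMatrix_map, ← hmeas, discard_measure]
  have h2 := congrArg conjTranspose hK
  rw [conjTranspose_mul, conjTranspose_mul, conjTranspose_mul] at h2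
  calc _ = (P.appendLocal C).discard
        ((liftOp (P.bobLocal.trans (P.appendLocal C).bobWires) (circuitMatrix C) *
        (liftOp (P.aliceLocal.trans (P.appendLocal C).aliceWires) (circuitMatrix C) *
          padOp (P.oldWires C))) * τ *
        ((padOp (P.oldWires C))ᴴ *
          (liftOp (P.aliceLocal.trans (P.appendLocal C).aliceWires) (circuitMatrix C))ᴴ *
          (liftOp (P.bobLocal.trans (P.appendLocal C).bobWires) (circuitMatrix C))ᴴ)) := by
        simp only [Matrix.mul_assoc]
    _ = (P.appendLocal C).discard (liftOp (P.appendLocal C).outWires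
          (sumKron (UA : Matrix (Bits (Fin mA)) (Bits (Fin mA)) ℂ)
            (UB : Matrix (Bits (Fin mB)) (Bits (Fin mB)) ℂ)) * (J * τ * Jᴴ) *
          (liftOp (P.appendLocal C).outWires
          (sumKron (UA : Matrix (Bits (Fin mA)) (Bits (Fin mA)) ℂ)
            (UB : Matrix (Bits (Fin mB)) (Bits (Fin mB)) ℂ)))ᴴ) := by
        rw [hK, h2]
        simp only [Matrix.mul_assoc]
    _ = _ := by
        rw [discard_liftOp_conj, discard_eq_ptr, hJ, ← discard_eq_ptr]
        rfl

end LOCCCircuit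

/-! ### Efficient local unitaries do not change the cost -/

theorem PolyBounded.add {f g : ℕ+ → ℕ} (hf : PolyBounded f) (hg : PolyBounded g) :
    PolyBounded fun l => f l + g l := by
  obtain ⟨p, hp⟩ := hf
  obtain ⟨q, hq⟩ := hg
  refine ⟨p + q, fun l => ?_⟩
  rw [Polynomial.eval_add]
  push_cast
  exact add_le_add (hp l) (hq l)

theorem IsEfficientLocalUnitary.inv {G : Set Gate} (hinv : ∀ g ∈ G, (⟨g.1, g.2⁻¹⟩ : Gate) ∈ G)
    {nA nB : ℕ+ → ℕ+} {UA : ∀ l, Matrix.unitaryGroup (Bits (Fin (nA l))) ℂ}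
    {UB : ∀ l, Matrix.unitaryGroup (Bits (Fin (nB l))) ℂ} (h : IsEfficientLocalUnitary G UA UB) :
    IsEfficientLocalUnitary G (fun l => (UA l)⁻¹) (fun l => (UB l)⁻¹) := by
  obtain ⟨c, hc, h⟩ := h
  refine ⟨c, hc, fun l => ?_⟩
  obtain ⟨t, C, hC, hlen⟩ := h l
  obtain ⟨D, hD, hDC⟩ := exists_circuitMatrix_eq_conjTranspose hinv C
  exact ⟨t, D, hC.inv hDC, hD ▸ hlen⟩

theorem CostAtMost.localConj {G : Set Gate} {ε : ℕ+ → ℝ} {nA nB : ℕ+ → ℕ+}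
    {ρ : ∀ l, BiOp (nA l) (nB l)} {n : ℕ+ → ℕ+}
    {UA : ∀ l, Matrix.unitaryGroup (Bits (Fin (nA l))) ℂ}
    {UB : ∀ l, Matrix.unitaryGroup (Bits (Fin (nB l))) ℂ}
    (hA : PolyBounded fun l => nA l) (hB : PolyBounded fun l => nB l)
    (hU : IsEfficientLocalUnitary G UA UB) (h : CostAtMost G ε ρ n) :
    CostAtMost G ε (fun l => localConj (UA l) (UB l) (ρ l)) n := by
  obtain ⟨Γ, ⟨c, hc, hP⟩, hF⟩ := h
  obtain ⟨c', hc', hC⟩ := hU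
  refine ⟨fun l σ => _root_.localConj (UA l) (UB l) (Γ l σ),
    ⟨fun l => c l + (c l + c l) + (nA l + nB l) + (c' l + c' l),
      ((hc.add (hc.add hc)).add (hA.add hB)).add (hc'.add hc'), fun l => ?_⟩, fun l => ?_⟩
  · obtain ⟨P, hPΓ, hsize⟩ := hP l
    obtain ⟨t, C, himp, hlen⟩ := hC l
    refine ⟨P.appendLocal C, ?_, ?_⟩
    · funext σ
      rw [P.channel_appendLocal himp, hPΓ]
    · have hq : P.q ≤ P.size := by
        rw [LOCCCircuit.size]
        omega
      rw [P.size_appendLocal]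
      beta_reduce
      omega
  · rw [fidelity_localConj]
    exact hF l

/-! ### Counting the outputs of LOCC circuits -/

namespace PlacedGate

variable {G : Set Gate} {W : Type} [Fintype W]

theorem injective_toSigma : Function.Injective
    (fun g : PlacedGate G W => (⟨⟨g.gate, g.mem⟩, g.wires⟩ : Σ g : G, Fin g.1.1 ↪ W)) := by
  rintro ⟨g, hg, w⟩ ⟨g', hg', w'⟩ h
  simp only [Sigma.mk.injEq, Subtype.mk.injEq] at h
  obtain ⟨rfl, h⟩ := h
  cases h
  rfl

theorem finite (hfin : G.Finite) : Finite (PlacedGate G W) :=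
  have := hfin.to_subtype
  Finite.of_injective _ injective_toSigma

theorem card_le (hfin : G.Finite) {K : ℕ} (hK : ∀ g ∈ G, g.1 ≤ K) (hW : 1 ≤ Fintype.card W) :
    Nat.card (PlacedGate G W) ≤ Nat.card G * Fintype.card W ^ K := by
  classical
  have := hfin.to_subtype
  have := Fintype.ofFinite G
  calc Nat.card (PlacedGate G W) ≤ Nat.card (Σ g : G, Fin g.1.1 ↪ W) :=
        Nat.card_le_card_of_injective _ injective_toSigma
    _ = ∑ g : G, (Fintype.card W).descFactorial g.1.1 := by
        rw [Nat.card_eq_fintype_card, Fintype.card_sigma]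
        simp [Fintype.card_embedding_eq]
    _ ≤ ∑ g : G, Fintype.card W ^ K := by
        refine Finset.sum_le_sum fun g _ => (Nat.descFactorial_le_pow _ _).trans ?_
        exact Nat.pow_le_pow_right hW (hK _ g.2)
    _ = _ := by simp

end PlacedGate

namespace LOCCCircuit

open Matrix

variable {G : Set Gate} {kA kB mA mB : ℕ} (P : LOCCCircuit G kA kB mA mB)

theorem trace_measure (τ : P.Op) : (P.measure τ).trace = τ.trace := by
  simp [trace, measure]

theorem trace_applyCircuit (C : Circuit G P.Wires) (τ : P.Op) :
    (P.applyCircuit C τ).trace = τ.trace := by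
  rw [applyCircuit, trace_mul_comm, ← Matrix.mul_assoc, conjTranspose_mul_circuitMatrix,
    Matrix.one_mul]

theorem trace_foldl_round
    (l : List (Circuit G (Fin (kA + P.tA) ⊕ Fin P.q) × Circuit G (Fin (kB + P.tB) ⊕ Fin P.q)))
    (τ : P.Op) : (l.foldl P.round τ).trace = τ.trace := by
  induction l generalizing τ with
  | nil => rfl
  | cons R l ih =>
    rw [List.foldl_cons, ih, round, trace_measure, trace_applyCircuit, trace_measure,
      trace_applyCircuit]

theorem trace_initial (σ : BiOp kA kB) : (P.initial σ).trace = σ.trace := by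
  classical
  simp only [trace, diag_apply, initial, and_self]
  rw [← Finset.sum_filter]
  refine Finset.sum_bij' (fun x _ => P.inputBits x)
    (fun c _ => Sum.elim (Fin.append c.1 0) (Sum.elim 0 (Fin.append c.2 0))) ?_ ?_ ?_ ?_ ?_
  · simp
  · rintro c -
    refine Finset.mem_filter.2 ⟨Finset.mem_univ _, fun i => ?_, fun i => rfl, fun i => ?_⟩
    · exact Fin.append_right _ _ i
    · exact Fin.append_right _ _ i
  · intro x hx
    obtain ⟨hA, hq, hB⟩ := (Finset.mem_filter.1 hx).2
    ext1 w
    rcases w with i | i | i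
    · refine Fin.addCases (fun i => ?_) (fun i => ?_) i
      · simp [inputBits]
      · simp [hA]
    · simp [hq]
    · refine Fin.addCases (fun i => ?_) (fun i => ?_) i
      · simp [inputBits]
      · simp [hB]
  · rintro c -
    simp [inputBits]
  · simp

theorem trace_channel (σ : BiOp kA kB) : (P.channel σ).trace = σ.trace := by
  rw [channel, trace_discard, trace_foldl_round, trace_initial]

/-- An elementary step of an LOCC circuit: nothing, the measurement of the register, or a gate. -/
def step : Option (Option (PlacedGate G P.Wires)) → P.Op → P.Op
  | none, τ => τ
  | some none, τ => P.measure τ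
  | some (some g), τ => g.toMatrix * τ * g.toMatrixᴴ

theorem applyCircuit_eq_foldl (C : Circuit G P.Wires) (τ : P.Op) :
    P.applyCircuit C τ = (C.map fun g => some (some g)).foldl (fun τ s => P.step s τ) τ := by
  induction C generalizing τ with
  | nil => simp [applyCircuit, circuitMatrix_nil]
  | cons g C ih =>
    rw [List.map_cons, List.foldl_cons, ← ih, step, applyCircuit, applyCircuit, circuitMatrix_cons,
      conjTranspose_mul]
    simp only [Matrix.mul_assoc]

theorem measure_of_q_eq_zero (hq : P.q = 0) (τ : P.Op) : P.measure τ = τ := by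
  ext x y
  rw [measure, if_pos]
  intro i
  exact (Fin.cast hq i).elim0

/-- A measurement is one step, and none if the register is empty. Thus rounds that do not contribute
to the size need no steps, although the size does not bound their number. -/
theorem exists_steps_measure (τ : P.Op) :
    ∃ L : List (Option (Option (PlacedGate G P.Wires))), L.length ≤ P.q ∧
      P.measure τ = L.foldl (fun τ s => P.step s τ) τ := by
  by_cases hq : P.q = 0
  · exact ⟨[], by simp, P.measure_of_q_eq_zero hq τ⟩
  · exact ⟨[some none], by simp; omega, rfl⟩

theorem exists_steps_foldl_round
    (l : List (Circuit G (Fin (kA + P.tA) ⊕ Fin P.q) × Circuit G (Fin (kB + P.tB) ⊕ Fin P.q)))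
    (τ : P.Op) :
    ∃ L : List (Option (Option (PlacedGate G P.Wires))),
      L.length ≤ (l.map fun R => R.1.length + R.2.length + 2 * P.q).sum ∧
      l.foldl P.round τ = L.foldl (fun τ s => P.step s τ) τ := by
  induction l generalizing τ with
  | nil => exact ⟨[], by simp, rfl⟩
  | cons R l ih =>
    obtain ⟨L, hL, h⟩ := ih (P.round τ R)
    obtain ⟨L₁, hL₁, h₁⟩ := P.exists_steps_measure
      (P.applyCircuit (R.1.map (PlacedGate.map P.aliceWires)) τ)
    obtain ⟨L₂, hL₂, h₂⟩ := P.exists_steps_measure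
      (P.applyCircuit (R.2.map (PlacedGate.map P.bobWires))
        (P.measure (P.applyCircuit (R.1.map (PlacedGate.map P.aliceWires)) τ)))
    refine ⟨(R.1.map (PlacedGate.map P.aliceWires)).map (fun g => some (some g)) ++ L₁ ++
      ((R.2.map (PlacedGate.map P.bobWires)).map (fun g => some (some g)) ++ L₂) ++ L, ?_, ?_⟩
    · simp only [List.length_append, List.length_map, List.map_cons, List.sum_cons]
      omega
    · rw [List.foldl_cons, h, List.foldl_append, List.foldl_append, List.foldl_append,
        List.foldl_append, ← applyCircuit_eq_foldl, ← applyCircuit_eq_foldl, ← h₁, ← h₂]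
      rfl

/-- A list of at most `s` steps can be padded with empty steps to length `s`. -/
theorem foldl_step_ofFn (s : ℕ) (L : List (Option (Option (PlacedGate G P.Wires))))
    (hL : L.length ≤ s) (τ : P.Op) :
    L.foldl (fun τ s => P.step s τ) τ =
      (List.ofFn fun i : Fin s => (L[(i : ℕ)]?).join).foldl (fun τ s => P.step s τ) τ := by
  induction s generalizing L τ with
  | zero => simp [List.length_eq_zero_iff.1 (Nat.le_zero.1 hL)]
  | succ s ih =>
    rw [List.ofFn_succ, List.foldl_cons]
    cases L with
    | nil =>
      have := ih [] (by simp) τ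
      simpa [step] using this
    | cons a L =>
      rw [List.foldl_cons, ih L (by simpa using hL)]
      simp

/-- The LOCC circuit with the given numbers of ancillas, and without rounds. -/
def noRounds (G : Set Gate) (n tA tB q : ℕ) : LOCCCircuit G n n n n where
  tA := tA
  tB := tB
  q := q
  rounds := []
  outA := by omega
  outB := by omega

/-- Codes for the LOCC circuits of size at most `s`: the numbers of ancillas and register qubits,
and a sequence of exactly `s` elementary steps, where empty steps serve as padding. -/
abbrev Code (G : Set Gate) (n s : ℕ) : Type :=
  Σ t : Fin (s + 1) × Fin (s + 1) × Fin (s + 1),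
    Fin s → Option (Option (PlacedGate G (noRounds G n t.1 t.2.1 t.2.2).Wires))

/-- The output on input `σ` of the LOCC circuit with the given code. -/
def Code.output {n s : ℕ} (σ : BiOp n n) (c : Code G n s) : BiOp n n :=
  (noRounds G n c.1.1 c.1.2.1 c.1.2.2).discard
    ((List.ofFn c.2).foldl (fun τ s => (noRounds G n c.1.1 c.1.2.1 c.1.2.2).step s τ)
      ((noRounds G n c.1.1 c.1.2.1 c.1.2.2).initial σ))

theorem exists_code {n s : ℕ} (P : LOCCCircuit G n n n n) (hP : P.size ≤ s) (σ : BiOp n n) :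
    ∃ c : Code G n s, P.channel σ = c.output σ := by
  obtain ⟨L, hL, h⟩ := P.exists_steps_foldl_round P.rounds (P.initial σ)
  rw [size] at hP
  rw [P.foldl_step_ofFn s L (hL.trans (by omega))] at h
  refine ⟨⟨(⟨P.tA, by omega⟩, ⟨P.tB, by omega⟩, ⟨P.q, by omega⟩),
    fun i => (L[(i : ℕ)]?).join⟩, ?_⟩
  have hstep : P.step = (noRounds G n P.tA P.tB P.q).step := by
    funext s
    rcases s with _ | _ | g <;> rfl
  rw [channel, h, hstep]
  rfl

theorem finite_code (hfin : G.Finite) (n s : ℕ) : Finite (Code G n s) := by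
  have : ∀ W : Type, [Fintype W] → Finite (PlacedGate G W) := fun W _ => PlacedGate.finite hfin
  infer_instance

theorem card_code_le (hfin : G.Finite) {K : ℕ} (hK : ∀ g ∈ G, g.1 ≤ K) {n : ℕ} (hn : 1 ≤ n)
    (s : ℕ) :
    Nat.card (Code G n s) ≤ (s + 1) ^ 3 * (Nat.card G * (2 * n + 3 * s) ^ K + 2) ^ s := by
  classical
  have : ∀ W : Type, [Fintype W] → Finite (PlacedGate G W) := fun W _ => PlacedGate.finite hfin
  have : ∀ W : Type, [Fintype W] → Fintype (PlacedGate G W) := fun W _ =>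
    Fintype.ofFinite _
  rw [Nat.card_eq_fintype_card, Fintype.card_sigma]
  calc _ ≤ ∑ t : Fin (s + 1) × Fin (s + 1) × Fin (s + 1),
        (Nat.card G * (2 * n + 3 * s) ^ K + 2) ^ s := by
        refine Finset.sum_le_sum fun t _ => ?_
        have hcard : Fintype.card (noRounds G n t.1 t.2.1 t.2.2).Wires =
            n + t.1 + (t.2.2 + (n + t.2.1)) := by
          rw [Fintype.card_sum, Fintype.card_sum, Fintype.card_fin, Fintype.card_fin,
            Fintype.card_fin]
          rfl
        rw [Fintype.card_fun, Fintype.card_option, Fintype.card_option, Fintype.card_fin]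
        refine Nat.pow_le_pow_left ?_ s
        have h1 := PlacedGate.card_le (W := (noRounds G n t.1 t.2.1 t.2.2).Wires) hfin hK
          (by omega)
        rw [Nat.card_eq_fintype_card] at h1
        have h2 : Nat.card G * Fintype.card (noRounds G n t.1 t.2.1 t.2.2).Wires ^ K ≤
            Nat.card G * (2 * n + 3 * s) ^ K := by
          gcongr
          have := t.1.2
          have := t.2.1.2
          have := t.2.2.2
          omega
        omega
    _ = _ := by
        simp
        ring

/-- Without ancillas and rounds the channel is the identity. -/
theorem channel_noRounds {n : ℕ} (σ : BiOp n n) : (noRounds G n 0 0 0).channel σ = σ := by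
  have hanc : ∀ x, (noRounds G n 0 0 0).AncillaZero x := by
    refine fun x => ⟨fun i => ?_, fun i => ?_, fun i => ?_⟩ <;> exact Fin.elim0 i
  have hagree : ∀ x y, (noRounds G n 0 0 0).AgreeOffOutput x y := by
    intro x y
    refine ⟨fun i hi => absurd i.2 (not_lt.2 hi), fun i => ?_, fun i hi => absurd i.2 (not_lt.2 hi)⟩
    exact Fin.elim0 i
  let e : Bits (noRounds G n 0 0 0).Wires ≃ BiBits n n :=
    { toFun := (noRounds G n 0 0 0).outputBits
      invFun := fun c => Sum.elim c.1 (Sum.elim (fun i => Fin.elim0 i) c.2)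
      left_inv := fun x => by
        ext1 w
        rcases w with i | i | i
        · rfl
        · exact Fin.elim0 i
        · rfl
      right_inv := fun c => rfl }
  ext a b
  have h : (noRounds G n 0 0 0).channel σ a b =
      ∑ x, ∑ y, if e x = a ∧ e y = b then σ (e x) (e y) else 0 := by
    refine Finset.sum_congr rfl fun x _ => Finset.sum_congr rfl fun y _ => ?_
    refine if_congr (and_congr_right fun _ => and_iff_left (hagree x y)) ?_ rfl
    exact if_pos (e := (0 : ℂ)) (And.intro (hanc x) (hanc y))
  rw [h, e.sum_comp fun x => ∑ y, if x = a ∧ e y = b then σ x (e y) else 0]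
  rw [Finset.sum_congr rfl fun x _ => e.sum_comp fun y => if x = a ∧ y = b then σ x y else 0]
  simp [ite_and]

end LOCCCircuit

/-! ### EPR pairs -/

section EPR

open Matrix

theorem eprVec_apply (n : ℕ) (x : BiBits n n) :
    eprVec n x = if x.1 = x.2 then (((1 / Real.sqrt 2 : ℝ) : ℂ)) ^ n else 0 := by
  rw [eprVec]
  split_ifs with h
  · simp [eprAmp, h]
  · obtain ⟨i, hi⟩ := Function.ne_iff.1 h
    exact Finset.prod_eq_zero (Finset.mem_univ i) (if_neg hi)

theorem star_mul_eprVec (n : ℕ) (x : BiBits n n) :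
    star (eprVec n x) * eprVec n x = if x.1 = x.2 then ((2 : ℂ) ^ n)⁻¹ else 0 := by
  rw [eprVec_apply]
  split_ifs
  · rw [star_pow, ← mul_pow, Complex.star_def, Complex.conj_ofReal, ← Complex.ofReal_mul,
      ← inv_pow]
    congr 1
    rw [div_mul_div_comm, Real.mul_self_sqrt zero_le_two]
    norm_num
  · simp

/-- Applying phases to Alice's halves of EPR pairs: the overlap of two such states is the mean of
the relative phase. -/
theorem dotProduct_phase_eprVec (n : ℕ) (u v : Bits (Fin n) → ℂ) :
    star (fun x : BiBits n n => u x.1 * eprVec n x) ⬝ᵥ (fun x => v x.1 * eprVec n x) =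
      ((2 : ℂ) ^ n)⁻¹ * ∑ x, star (u x) * v x := by
  rw [dotProduct, Fintype.sum_prod_type, Finset.mul_sum]
  refine Finset.sum_congr rfl fun x _ => ?_
  rw [Finset.sum_eq_single x]
  · have := star_mul_eprVec n (x, x)
    rw [if_pos rfl] at this
    rw [Pi.star_apply, star_mul', ← this]
    ring
  · intro y _ hy
    simp [eprVec_apply, hy.symm]
  · simp

theorem star_dotProduct_eprVec (n : ℕ) : star (eprVec n) ⬝ᵥ eprVec n = 1 := by
  have h := dotProduct_phase_eprVec n (fun _ => 1) (fun _ => 1)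
  simp only [one_mul, star_one] at h
  refine h.trans ?_
  simp

theorem posSemidef_eprState (n : ℕ) : (eprState n).PosSemidef :=
  posSemidef_vecMulVec_self_star _

theorem trace_eprState (n : ℕ) : (eprState n).trace = 1 := by
  rw [eprState, trace_vecMulVec, dotProduct_comm, star_dotProduct_eprVec]

theorem fidelity_eprState (n : ℕ) : fidelity (eprState n) (eprState n) = 1 := by
  rw [show fidelity (eprState n) (eprState n) =
    fidelity (eprState n) (vecMulVec (eprVec n) (star (eprVec n))) from rfl,
    fidelity_pure (posSemidef_eprState n) (star_dotProduct_eprVec n), eprState, vecMulVec_mulVec]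
  simp [star_dotProduct_eprVec]

theorem localConj_diagonal_eprState {n : ℕ} (UA : unitaryGroup (Bits (Fin n)) ℂ)
    {u : Bits (Fin n) → ℂ} (hu : (UA : Matrix (Bits (Fin n)) (Bits (Fin n)) ℂ) = diagonal u) :
    localConj UA 1 (eprState n) =
      vecMulVec (fun x : BiBits n n => u x.1 * eprVec n x)
        (star fun x : BiBits n n => u x.1 * eprVec n x) := by
  have h1 : ((1 : unitaryGroup (Bits (Fin n)) ℂ) : Matrix (Bits (Fin n)) (Bits (Fin n)) ℂ) =
      diagonal fun _ => 1 := diagonal_one.symm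
  have h2 : (diagonal (fun x : BiBits n n => u x.1 * 1)) *ᵥ eprVec n =
      fun x : BiBits n n => u x.1 * eprVec n x := by
    ext x
    rw [mulVec_diagonal, mul_one]
  rw [localConj, hu, h1, diagonal_kronecker_diagonal, eprState, mul_vecMulVec, vecMulVec_mul, h2,
    ← star_mulVec, h2]

end EPR

/-! ### Polynomial phase states -/

section PhaseStates

open Matrix

variable {F : Type} [Field F] [Fintype F] [DecidableEq F]

/-- Two different polynomials of degree less than `D` agree in at most `D` points. -/
theorem card_eval_ofFn_eq_le {D : ℕ} {c d : Fin D → F} (hcd : c ≠ d) :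
    (Finset.univ.filter fun a : F =>
      (Polynomial.ofFn D d).eval a - (Polynomial.ofFn D c).eval a = 0).card ≤ D := by
  set p := Polynomial.ofFn D (d - c) with hp
  have hp0 : p ≠ 0 := by
    rw [hp, Ne, ← map_zero (Polynomial.ofFn D), (Polynomial.injective_ofFn D).eq_iff, sub_eq_zero]
    exact hcd.symm
  have hD : D ≠ 0 := Polynomial.ne_zero_of_ofFn_ne_zero hp0
  calc _ ≤ p.natDegree := by
        refine Polynomial.card_le_degree_of_subset_roots (fun a ha => ?_)
        rw [Polynomial.mem_roots hp0, Polynomial.IsRoot, hp, map_sub, Polynomial.eval_sub]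
        exact (Finset.mem_filter.1 ha).2
    _ ≤ D := (Polynomial.ofFn_natDegree_lt (by omega) _).le

/-- The phase `ψ(p(a) b)` attached to the label `x`, which a bijection identifies with a triple
`(a, b, r)`; here `p` is the polynomial with coefficients `c`. -/
def phase {n D : ℕ} {R : Type} (ψ : AddChar F ℂ) (e : Bits (Fin n) ≃ F × F × R) (c : Fin D → F)
    (x : Bits (Fin n)) : ℂ :=
  ψ ((Polynomial.ofFn D c).eval (e x).1 * (e x).2.1)

variable {n D : ℕ} {R : Type} [Fintype R] {ψ : AddChar F ℂ} (e : Bits (Fin n) ≃ F × F × R)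

theorem star_phase_mul_phase (c d : Fin D → F) (x : Bits (Fin n)) :
    star (phase ψ e c x) * phase ψ e d x =
      ψ ((e x).2.1 *
        ((Polynomial.ofFn D d).eval (e x).1 - (Polynomial.ofFn D c).eval (e x).1)) := by
  rw [phase, phase, Complex.star_def, ← AddChar.map_neg_eq_conj, ← AddChar.map_add_eq_mul]
  congr 1
  ring

theorem star_phase_mul_phase_self (c : Fin D → F) (x : Bits (Fin n)) :
    star (phase ψ e c x) * phase ψ e c x = 1 := by
  rw [star_phase_mul_phase, sub_self, mul_zero, AddChar.map_zero_eq_one]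

/-- The diagonal unitary with the polynomial phases on its diagonal. -/
def phaseUnitary (ψ : AddChar F ℂ) (e : Bits (Fin n) ≃ F × F × R) (c : Fin D → F) :
    unitaryGroup (Bits (Fin n)) ℂ :=
  ⟨diagonal (phase ψ e c), by
    rw [mem_unitaryGroup_iff', star_eq_conjTranspose, diagonal_conjTranspose, diagonal_mul_diagonal,
      ← diagonal_one]
    congr 1
    ext1 x
    exact star_phase_mul_phase_self e c x⟩

theorem norm_dotProduct_phase_le (hψ : ψ.IsPrimitive) {c d : Fin D → F} (hcd : c ≠ d) :
    ‖star (fun x : BiBits n n => phase ψ e c x.1 * eprVec n x) ⬝ᵥ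
      (fun x => phase ψ e d x.1 * eprVec n x)‖ ≤ D / Fintype.card F := by
  set Z := Finset.univ.filter fun a : F =>
      (Polynomial.ofFn D d).eval a - (Polynomial.ofFn D c).eval a = 0 with hZ
  have hcard : (2 : ℂ) ^ n = Fintype.card F * (Fintype.card F * Fintype.card R) := by
    have := Fintype.card_congr e
    simp only [Fintype.card_fun, Fintype.card_fin, Fintype.card_prod] at this
    exact_mod_cast this
  have hF : (Fintype.card F : ℂ) ≠ 0 := Nat.cast_ne_zero.2 Fintype.card_ne_zero
  have hR : (Fintype.card R : ℂ) ≠ 0 := fun h => by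
    rw [h, mul_zero, mul_zero] at hcard
    exact pow_ne_zero n two_ne_zero hcard
  have hsum : ∑ x, star (phase ψ e c x) * phase ψ e d x =
      Z.card * (Fintype.card F * Fintype.card R) := by
    simp only [star_phase_mul_phase]
    rw [Equiv.sum_comp e (fun y : F × F × R => (ψ (y.2.1 *
      ((Polynomial.ofFn D d).eval y.1 - (Polynomial.ofFn D c).eval y.1)) : ℂ)),
      Fintype.sum_prod_type]
    simp only [Fintype.sum_prod_type, Finset.sum_const, Finset.card_univ, nsmul_eq_mul,
      ← Finset.mul_sum, AddChar.sum_mulShift _ hψ]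
    rw [hZ, Finset.card_filter]
    push_cast
    rw [Finset.sum_mul, Finset.mul_sum]
    refine Finset.sum_congr rfl fun a _ => ?_
    split_ifs <;> simp [mul_comm]
  have hval : ((2 : ℂ) ^ n)⁻¹ * (Z.card * (Fintype.card F * Fintype.card R)) =
      Z.card / Fintype.card F := by
    rw [hcard]
    field_simp
  rw [dotProduct_phase_eprVec, hsum, hval, norm_div, Complex.norm_natCast, Complex.norm_natCast]
  gcongr
  exact_mod_cast card_eval_ofFn_eq_le hcd

/-- Among the polynomial phase states there is one that none of a small number of density matrices
approximates. -/
theorem exists_unitary_fidelity_lt {n m D : ℕ} (hm : m ≠ 0) (hmn : 2 * m ≤ n) {Ω : Type} [Finite Ω]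
    (σ : Ω → BiOp n n) (hσ : ∀ ω, (σ ω).trace = 1) {θ : ℝ} (hθ : 0 < θ)
    (hD : 2 * (D : ℝ) ≤ θ * 2 ^ m)
    (hcount : (Nat.card Ω : ℝ) * 4 < 3 * θ ^ 2 * (2 ^ m) ^ D) :
    ∃ U : unitaryGroup (Bits (Fin n)) ℂ,
      ∀ ω, fidelity (σ ω) (localConj U 1 (eprState n)) < θ := by
  classical
  have := Fintype.ofFinite Ω
  -- two copies of the field use `2 m` of the qubits, the phase ignores the others
  let F := GaloisField 2 m
  have : Fintype F := Fintype.ofFinite F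
  have hF : Fintype.card F = 2 ^ m := by
    rw [← Nat.card_eq_fintype_card]
    exact GaloisField.card 2 m hm
  let e : Bits (Fin n) ≃ F × F × Bits (Fin (n - 2 * m)) := by
    refine Fintype.equivOfCardEq ?_
    simp only [Fintype.card_fun, Fintype.card_fin, Fintype.card_prod, hF]
    rw [← mul_assoc, ← pow_add, ← pow_add]
    congr 1
    omega
  obtain ⟨ψ, hψ⟩ : ∃ ψ : AddChar F ℂ, ψ.IsPrimitive :=
    ⟨_, AddChar.FiniteField.primitiveChar_to_Complex_isPrimitive F⟩
  by_contra! hall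
  have h : ∀ c : Fin D → F, ∃ ω,
      θ ≤ fidelity (σ ω) (localConj (phaseUnitary ψ e c) 1 (eprState n)) :=
    fun c => hall _
  choose f hf using h
  -- `f` maps few polynomials to the same density matrix, but there are too many polynomials
  have hnorm : ∀ c : Fin D → F, star (fun x : BiBits n n => phase ψ e c x.1 * eprVec n x) ⬝ᵥ
      (fun x => phase ψ e c x.1 * eprVec n x) = 1 := fun c => by
    rw [dotProduct_phase_eprVec, Finset.sum_congr rfl fun x _ => star_phase_mul_phase_self e c x]
    simp
  have hδ : (D : ℝ) / Fintype.card F ≤ θ / 2 := by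
    rw [hF]
    push_cast
    rw [div_le_div_iff₀ (by positivity) two_pos]
    linarith
  have hfib : ∀ ω, ((Finset.univ.filter fun c => f c = ω).card : ℝ) * (3 * θ ^ 2) ≤ 4 := fun ω => by
    set S := Finset.univ.filter fun c => f c = ω
    rcases S.eq_empty_or_nonempty with hS | ⟨c₀, hc₀⟩
    · rw [hS]
      simp
    have hfS : ∀ c ∈ S, θ ≤ fidelity (σ ω) (localConj (phaseUnitary ψ e c) 1 (eprState n)) :=
      fun c hc => (Finset.mem_filter.1 hc).2 ▸ hf c
    have hpsd : (σ ω).PosSemidef := by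
      by_contra hneg
      have := hfS c₀ hc₀
      rw [fidelity_of_not_posSemidef hneg] at this
      linarith
    have h1 := card_overlap_le hpsd (hσ ω) S
      (fun c => (fun x : BiBits n n => phase ψ e c x.1 * eprVec n x)) hnorm
      (δ := (θ / 2) ^ 2) (θ := θ) (sq_nonneg _)
      (fun c d hcd => by
        gcongr
        exact (norm_dotProduct_phase_le e hψ hcd).trans hδ) hθ.le
      (fun c hc => by
        have := hfS c hc
        rwa [localConj_diagonal_eprState _ (u := phase ψ e c) rfl, fidelity_pure hpsd (hnorm c)]
          at this)
    have h2 : (0 : ℝ) < S.card := by exact_mod_cast Finset.card_pos.2 ⟨c₀, hc₀⟩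
    have h3 : (S.card : ℝ) * (S.card * (3 * θ ^ 2)) ≤ S.card * 4 := by nlinarith
    exact le_of_mul_le_mul_left h3 h2
  have hcardF : (Fintype.card (Fin D → F) : ℝ) = (2 ^ m) ^ D := by
    rw [Fintype.card_fun, Fintype.card_fin, hF]
    push_cast
    rfl
  have hsum : (Fintype.card (Fin D → F) : ℝ) =
      ∑ ω, ((Finset.univ.filter fun c => f c = ω).card : ℝ) := by
    rw [← Finset.card_univ, Finset.card_eq_sum_card_fiberwise (f := f) (t := Finset.univ) (by simp)]
    push_cast
    rfl
  have hle : (2 ^ m) ^ D * (3 * θ ^ 2) ≤ (Nat.card Ω : ℝ) * 4 := by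
    rw [← hcardF, hsum, Finset.sum_mul]
    refine (Finset.sum_le_sum fun ω _ => hfib ω).trans ?_
    simp
  linarith

end PhaseStates

/-! ### Unitaries that are hard for polynomial size -/

section Hard

open Filter

theorem eventually_polynomial_eval_le_pow (p : Polynomial ℝ) :
    ∃ k : ℕ, ∀ᶠ l : ℕ+ in atTop, p.eval ((l : ℕ) : ℝ) ≤ ((l : ℕ) : ℝ) ^ k := by
  set S := ∑ i ∈ Finset.range (p.natDegree + 1), |p.coeff i| with hS
  refine ⟨p.natDegree + 1, ?_⟩
  filter_upwards [eventually_ge_atTop (⟨⌈S⌉₊ + 1, by omega⟩ : ℕ+)] with l hl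
  have hl1 : (1 : ℝ) ≤ (l : ℕ) := by exact_mod_cast l.2
  have hlS : S ≤ (l : ℕ) := by
    have : ⌈S⌉₊ + 1 ≤ (l : ℕ) := hl
    calc S ≤ ⌈S⌉₊ := Nat.le_ceil S
      _ ≤ (l : ℕ) := by exact_mod_cast (by omega : ⌈S⌉₊ ≤ (l : ℕ))
  rw [Polynomial.eval_eq_sum_range, pow_succ']
  calc _ ≤ ∑ i ∈ Finset.range (p.natDegree + 1), |p.coeff i| * ((l : ℕ) : ℝ) ^ p.natDegree := by
        refine Finset.sum_le_sum fun i hi => ?_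
        have := Finset.mem_range.1 hi
        gcongr
        · exact le_abs_self _
        · omega
    _ = S * ((l : ℕ) : ℝ) ^ p.natDegree := by rw [hS, Finset.sum_mul]
    _ ≤ _ := by gcongr

theorem PolyBounded.eventually_le_pow {f : ℕ+ → ℕ} (hf : PolyBounded f) :
    ∃ k : ℕ, ∀ᶠ l : ℕ+ in atTop, f l ≤ (l : ℕ) ^ k := by
  obtain ⟨p, hp⟩ := hf
  obtain ⟨k, hk⟩ := eventually_polynomial_eval_le_pow p
  refine ⟨k, hk.mono fun l hl => ?_⟩
  exact_mod_cast (hp l).trans hl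

theorem eventually_pow_le_two_pow_half {n : ℕ+ → ℕ+}
    (hlog : (fun l : ℕ+ => Real.log ((l : ℕ) : ℝ)) =o[atTop] (fun l : ℕ+ => ((n l : ℕ) : ℝ)))
    (j : ℕ) : ∀ᶠ l : ℕ+ in atTop, (l : ℕ) ^ j ≤ 2 ^ ((n l : ℕ) / 2) := by
  have hc : (0 : ℝ) < 1 / (4 * j + 1) := by positivity
  filter_upwards [hlog.def hc, eventually_ge_atTop (3 : ℕ+)] with l hl hl3
  have hl3' : (3 : ℝ) ≤ (l : ℕ) := by exact_mod_cast (show 3 ≤ (l : ℕ) from hl3)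
  have hpos : (0 : ℝ) < (l : ℕ) := by linarith
  have hlog1 : 1 ≤ Real.log (l : ℕ) := by
    rw [Real.le_log_iff_exp_le hpos]
    exact (Real.exp_one_lt_d9.le.trans (by norm_num)).trans hl3'
  rw [Real.norm_of_nonneg (by linarith), Real.norm_of_nonneg (by positivity), div_mul_eq_mul_div,
    one_mul, le_div_iff₀ (by positivity)] at hl
  have hhalf : ((n l : ℕ) : ℝ) ≤ 2 * (((n l : ℕ) / 2 : ℕ) : ℝ) + 1 := by
    exact_mod_cast (by omega : (n l : ℕ) ≤ 2 * ((n l : ℕ) / 2) + 1)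
  have hlog2 : (1 : ℝ) / 2 ≤ Real.log 2 := by
    have := Real.log_two_gt_d9
    linarith
  have key : (j : ℝ) * Real.log (l : ℕ) ≤ (((n l : ℕ) / 2 : ℕ) : ℝ) * Real.log 2 := by
    calc (j : ℝ) * Real.log (l : ℕ) ≤ (((n l : ℕ) / 2 : ℕ) : ℝ) * (1 / 2) := by nlinarith
      _ ≤ _ := by gcongr
  have : (((l : ℕ) : ℝ)) ^ j ≤ 2 ^ ((n l : ℕ) / 2) := by
    rw [← Real.log_le_log_iff (by positivity) (by positivity), Real.log_pow, Real.log_pow]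
    exact key
  exact_mod_cast this

/-- `U` is hard for size `s`: no LOCC circuit of size at most `s` prepares `U ⊗ 1` applied to `n`
EPR pairs, from `n` EPR pairs and up to the error `ε`. -/
def IsHard (G : Set Gate) (ε : ℝ) {n : ℕ} (s : ℕ)
    (U : Matrix.unitaryGroup (Bits (Fin n)) ℂ) : Prop :=
  ∀ P : LOCCCircuit G n n n n, P.size ≤ s →
    ε < 1 - fidelity (P.channel (eprState n)) (localConj U 1 (eprState n))

variable {G : Set Gate}

/-- The number of codes for circuits of size `l ^ k` is exponential in `l ^ k * log l` only, and
thus, even with a polynomial factor to spare, at most the number of polynomials with `l ^ (k + 2)`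
coefficients over a field of at least `l` elements. -/
theorem card_code_le_pow (hfin : G.Finite) {K : ℕ} (hK : ∀ g ∈ G, g.1 ≤ K) (a b k : ℕ) {n l : ℕ}
    (hn : 1 ≤ n) (hnl : n ≤ l ^ b) (hl : 2 ≤ l) (hG : Nat.card G ≤ l)
    (hlarge : 2 * a + 3 * k + 5 + ((b + k + 3) * K + 2) ≤ l) :
    4 * l ^ (2 * a) * Nat.card (LOCCCircuit.Code G n (l ^ k)) ≤ l ^ l ^ (k + 2) := by
  have hpos : ∀ i, 1 ≤ l ^ i := fun i => Nat.one_le_pow _ _ (by omega)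
  have h1 : (l ^ k + 1) ^ 3 ≤ l ^ (3 * k + 3) := by
    calc (l ^ k + 1) ^ 3 ≤ (l ^ (k + 1)) ^ 3 := by
          gcongr
          rw [pow_succ]
          nlinarith [hpos k]
      _ = _ := by rw [← pow_mul]; congr 1; ring
  have h2 : 2 * n + 3 * l ^ k ≤ l ^ (b + k + 3) := by
    have h8 : 8 ≤ l ^ 3 := Nat.pow_le_pow_left hl 3
    have e1 : l ^ b ≤ l ^ b * l ^ k := Nat.le_mul_of_pos_right _ (hpos k)
    have e2 : l ^ k ≤ l ^ b * l ^ k := Nat.le_mul_of_pos_left _ (hpos b)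
    calc 2 * n + 3 * l ^ k ≤ l ^ b * l ^ k * 8 := by omega
      _ ≤ l ^ b * l ^ k * l ^ 3 := by gcongr
      _ = _ := by rw [← pow_add, ← pow_add]
  have h3 : Nat.card G * (2 * n + 3 * l ^ k) ^ K + 2 ≤ l ^ ((b + k + 3) * K + 2) := by
    have := hpos ((b + k + 3) * K)
    calc Nat.card G * (2 * n + 3 * l ^ k) ^ K + 2
        ≤ l * (l ^ (b + k + 3)) ^ K + 2 := by gcongr
      _ = l * l ^ ((b + k + 3) * K) + 2 := by rw [← pow_mul]
      _ ≤ l * l ^ ((b + k + 3) * K) * 2 := by nlinarith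
      _ ≤ l * l ^ ((b + k + 3) * K) * l := by gcongr
      _ = _ := by ring
  calc 4 * l ^ (2 * a) * Nat.card (LOCCCircuit.Code G n (l ^ k))
      ≤ l ^ 2 * l ^ (2 * a) * (l ^ (3 * k + 3) * (l ^ ((b + k + 3) * K + 2)) ^ l ^ k) := by
        have h4 : 4 ≤ l ^ 2 := Nat.pow_le_pow_left hl 2
        gcongr
        refine (LOCCCircuit.card_code_le hfin hK hn _).trans ?_
        gcongr
    _ = l ^ (2 * a + 3 * k + 5 + ((b + k + 3) * K + 2) * l ^ k) := by
        rw [← pow_mul, ← pow_add, ← pow_add, ← pow_add]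
        congr 1
        ring
    _ ≤ l ^ l ^ (k + 2) := by
        refine Nat.pow_le_pow_right (by omega) ?_
        calc 2 * a + 3 * k + 5 + ((b + k + 3) * K + 2) * l ^ k
            ≤ (2 * a + 3 * k + 5 + ((b + k + 3) * K + 2)) * l ^ k := by
              rw [add_mul (2 * a + 3 * k + 5)]
              gcongr
              exact Nat.le_mul_of_pos_right _ (hpos k)
          _ ≤ l * l ^ k := by gcongr
          _ = l ^ (k + 1) := by ring
          _ ≤ l ^ (k + 2) := Nat.pow_le_pow_right (by omega) (by omega)

theorem eventually_exists_isHard (hfin : G.Finite) {ε : ℕ+ → ℝ} {n : ℕ+ → ℕ+} {p : Polynomial ℝ}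
    (hp : ∀ l : ℕ+, 0 < p.eval ((l : ℕ) : ℝ) ∧ 1 / p.eval ((l : ℕ) : ℝ) ≤ 1 - ε l)
    (hn : PolyBounded fun l => n l)
    (hlog : (fun l : ℕ+ => Real.log ((l : ℕ) : ℝ)) =o[atTop] (fun l : ℕ+ => ((n l : ℕ) : ℝ)))
    (k : ℕ) : ∀ᶠ l : ℕ+ in atTop,
      ∃ U : Matrix.unitaryGroup (Bits (Fin (n l))) ℂ, IsHard G (ε l) ((l : ℕ) ^ k) U := by
  obtain ⟨a, ha⟩ := eventually_polynomial_eval_le_pow p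
  obtain ⟨b, hb⟩ := hn.eventually_le_pow
  -- the largest arity of a gate
  obtain ⟨K, hK⟩ : ∃ K, ∀ g ∈ G, g.1 ≤ K := by
    obtain ⟨K, hK⟩ := (hfin.image Sigma.fst).bddAbove
    exact ⟨K, fun g hg => hK ⟨g, hg, rfl⟩⟩
  -- The degree bound is `D = l ^ (k + 2)`, which beats the number of codes, and a field of size
  -- `l ^ (a + k + 3)` makes the overlaps `D / |F|` at most `θ / 2` for `θ = l ^ (-a)`.
  filter_upwards [ha, hb, eventually_pow_le_two_pow_half hlog (a + k + 3),
    eventually_ge_atTop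
      (⟨Nat.card G + 2 + (2 * a + 3 * k + 5 + ((b + k + 3) * K + 2)), by omega⟩ : ℕ+)]
    with l hal hbl hml hl
  have hl' : Nat.card G + 2 + (2 * a + 3 * k + 5 + ((b + k + 3) * K + 2)) ≤ (l : ℕ) := hl
  have hl2 : 2 ≤ (l : ℕ) := by omega
  have hl2' : (2 : ℝ) ≤ (l : ℕ) := by exact_mod_cast hl2
  have hl0 : (0 : ℝ) < (l : ℕ) := by linarith
  have hml' : ((l : ℕ) : ℝ) ^ (a + k + 3) ≤ 2 ^ ((n l : ℕ) / 2) := by exact_mod_cast hml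
  have hm : (n l : ℕ) / 2 ≠ 0 := fun h0 => by
    rw [h0, pow_zero] at hml
    have : 2 ^ 1 ≤ (l : ℕ) ^ (a + k + 3) :=
      (Nat.pow_le_pow_left hl2 1).trans (Nat.pow_le_pow_right (by omega) (by omega))
    omega
  have hcode := card_code_le_pow hfin hK a b k (n l).2 hbl hl2 (by omega) (by omega)
  have hcode' : 4 * ((l : ℕ) : ℝ) ^ (2 * a) * Nat.card (LOCCCircuit.Code G (n l) ((l : ℕ) ^ k)) ≤
      ((l : ℕ) : ℝ) ^ (l : ℕ) ^ (k + 2) := by exact_mod_cast hcode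
  have := LOCCCircuit.finite_code hfin (n l) ((l : ℕ) ^ k)
  -- only codes of actual circuits are known to give states of trace one
  obtain ⟨U, hU⟩ := exists_unitary_fidelity_lt (m := (n l : ℕ) / 2) (D := (l : ℕ) ^ (k + 2))
    (Ω := {c : LOCCCircuit.Code G (n l) ((l : ℕ) ^ k) // (c.output (eprState (n l))).trace = 1})
    (θ := 1 / ((l : ℕ) : ℝ) ^ a) hm (by omega) (fun c => c.1.output (eprState (n l)))
    (fun c => c.2) (by positivity)
    (by
      rw [one_div, ← div_eq_inv_mul, le_div_iff₀ (by positivity)]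
      push_cast
      calc 2 * ((l : ℕ) : ℝ) ^ (k + 2) * ((l : ℕ) : ℝ) ^ a
          ≤ (l : ℕ) * ((l : ℕ) : ℝ) ^ (k + 2) * ((l : ℕ) : ℝ) ^ a := by gcongr
        _ = ((l : ℕ) : ℝ) ^ (a + k + 3) := by ring
        _ ≤ _ := hml')
    (by
      have hsub : (Nat.card {c : LOCCCircuit.Code G (n l) ((l : ℕ) ^ k) //
          (c.output (eprState (n l))).trace = 1} : ℝ) ≤
          Nat.card (LOCCCircuit.Code G (n l) ((l : ℕ) ^ k)) := by
        exact_mod_cast Nat.card_le_card_of_injective _ Subtype.val_injective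
      have hpow : ((l : ℕ) : ℝ) ^ (l : ℕ) ^ (k + 2) ≤
          (2 ^ ((n l : ℕ) / 2)) ^ (l : ℕ) ^ (k + 2) := by
        gcongr
        refine le_trans ?_ hml'
        exact le_self_pow₀ (by linarith) (by omega)
      have hpos : (0 : ℝ) < (2 ^ ((n l : ℕ) / 2)) ^ (l : ℕ) ^ (k + 2) := by positivity
      rw [one_div, inv_pow, ← pow_mul, mul_comm a 2, mul_assoc, mul_comm _⁻¹, ← mul_assoc,
        ← div_eq_mul_inv, lt_div_iff₀ (by positivity)]
      calc _ ≤ 4 * ((l : ℕ) : ℝ) ^ (2 * a) *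
            Nat.card (LOCCCircuit.Code G (n l) ((l : ℕ) ^ k)) := by
            rw [mul_assoc, mul_comm]
            gcongr
        _ ≤ (2 ^ ((n l : ℕ) / 2)) ^ (l : ℕ) ^ (k + 2) := hcode'.trans hpow
        _ < _ := by linarith)
  refine ⟨U, fun P hP => ?_⟩
  obtain ⟨c, hc⟩ := LOCCCircuit.exists_code P hP (eprState (n l))
  have hlt := hU ⟨c, by rw [← hc, P.trace_channel, trace_eprState]⟩
  simp only [← hc] at hlt
  have hθ : 1 / ((l : ℕ) : ℝ) ^ a ≤ 1 / p.eval ((l : ℕ) : ℝ) :=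
    one_div_le_one_div_of_le (hp l).1 hal
  have := (hp l).2
  linarith

/-- The hard unitaries for the sizes `l ^ k` combine to one family that is hard for every
polynomial size. -/
theorem exists_not_costAtMost {ε : ℕ+ → ℝ} {n : ℕ+ → ℕ+}
    (h : ∀ k : ℕ, ∀ᶠ l : ℕ+ in atTop,
      ∃ U : Matrix.unitaryGroup (Bits (Fin (n l))) ℂ, IsHard G (ε l) ((l : ℕ) ^ k) U) :
    ∃ UA : ∀ l, Matrix.unitaryGroup (Bits (Fin (n l))) ℂ,
      ¬ CostAtMost G ε (fun l => localConj (UA l) 1 (eprState (n l))) n := by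
  classical
  -- at the parameter `l`, the largest exponent up to `l` for which a hard unitary exists
  let k₀ : ℕ+ → ℕ := fun l => Nat.findGreatest
    (fun k => ∃ U : Matrix.unitaryGroup (Bits (Fin (n l))) ℂ, IsHard G (ε l) ((l : ℕ) ^ k) U) l
  have hU : ∀ l, ∃ U : Matrix.unitaryGroup (Bits (Fin (n l))) ℂ,
      (∃ k ≤ (l : ℕ), ∃ U : Matrix.unitaryGroup (Bits (Fin (n l))) ℂ,
        IsHard G (ε l) ((l : ℕ) ^ k) U) → IsHard G (ε l) ((l : ℕ) ^ k₀ l) U := fun l => by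
    by_cases hex : ∃ k ≤ (l : ℕ), ∃ U : Matrix.unitaryGroup (Bits (Fin (n l))) ℂ,
        IsHard G (ε l) ((l : ℕ) ^ k) U
    · obtain ⟨k, hkl, hk⟩ := hex
      obtain ⟨U, hU⟩ := Nat.findGreatest_spec (P := fun k =>
        ∃ U : Matrix.unitaryGroup (Bits (Fin (n l))) ℂ, IsHard G (ε l) ((l : ℕ) ^ k) U) hkl hk
      exact ⟨U, fun _ => hU⟩
    · exact ⟨1, fun h => absurd h hex⟩
  choose UA hUA using hU
  refine ⟨UA, ?_⟩
  rintro ⟨Γ, ⟨c, hc, hP⟩, hF⟩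
  obtain ⟨k, hk⟩ := hc.eventually_le_pow
  obtain ⟨l, hcl, hhard, hkl⟩ :=
    (hk.and ((h k).and (eventually_ge_atTop (⟨k + 1, by omega⟩ : ℕ+)))).exists
  have hkl' : k ≤ (l : ℕ) := (Nat.le_succ k).trans hkl
  obtain ⟨P, hPΓ, hsize⟩ := hP l
  have hle : k ≤ k₀ l := Nat.le_findGreatest hkl' hhard
  have := hUA l ⟨k, hkl', hhard⟩ P
    (hsize.trans (hcl.trans (Nat.pow_le_pow_right l.2 hle)))
  rw [hPΓ] at this
  exact absurd (hF l) (not_le.2 this)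

end Hard

theorem costAtMost_eprState {G : Set Gate} {ε : ℕ+ → ℝ} (hε : ∀ l, 0 ≤ ε l) {n : ℕ+ → ℕ+} :
    CostAtMost G ε (fun l => eprState (n l)) n := by
  refine ⟨fun _ σ => σ, ⟨fun _ => 0, ⟨0, fun l => by simp⟩, fun l => ?_⟩, fun l => ?_⟩
  · exact ⟨LOCCCircuit.noRounds G (n l) 0 0 0, funext LOCCCircuit.channel_noRounds, le_rfl⟩
  · rw [fidelity_eprState, sub_self]
    exact hε l

end

/-! ### The cost under local unitaries -/

theorem mainTheorem5 (G : Set Gate) (hfin : G.Finite)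
    (hinv : ∀ g ∈ G, (⟨g.1, g.2⁻¹⟩ : Gate) ∈ G) :
    (∀ (ε : ℕ+ → ℝ) (nA nB : ℕ+ → ℕ+) (ρ : ∀ l, BiOp (nA l) (nB l)) (n : ℕ+ → ℕ+)
        (UA : ∀ l, Matrix.unitaryGroup (Bits (Fin (nA l))) ℂ)
        (UB : ∀ l, Matrix.unitaryGroup (Bits (Fin (nB l))) ℂ),
        (∀ l, ε l ∈ Set.Icc (0 : ℝ) 1) →
        PolyBounded (fun l => nA l) → PolyBounded (fun l => nB l) →
        (∀ l, IsDensity (ρ l)) →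
        IsEfficientLocalUnitary G UA UB →
        (CostAtMost G ε ρ n ↔ CostAtMost G ε (fun l => localConj (UA l) (UB l) (ρ l)) n)) ∧
    (∀ (ε : ℕ+ → ℝ) (n : ℕ+ → ℕ+),
        (∀ l, ε l ∈ Set.Icc (0 : ℝ) 1) →
        (∃ p : Polynomial ℝ, ∀ l : ℕ+,
          0 < p.eval ((l : ℕ) : ℝ) ∧ 1 / p.eval ((l : ℕ) : ℝ) ≤ 1 - ε l) →
        PolyBounded (fun l => n l) →
        (fun l : ℕ+ => Real.log ((l : ℕ) : ℝ)) =o[Filter.atTop]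
          (fun l : ℕ+ => ((n l : ℕ) : ℝ)) →
        ∃ (UA UB : ∀ l, Matrix.unitaryGroup (Bits (Fin (n l))) ℂ),
          CostAtMost G ε (fun l => eprState (n l)) n ∧
          ¬ CostAtMost G ε (fun l => localConj (UA l) (UB l) (eprState (n l))) n) := by
  refine ⟨?_, ?_⟩
  · intro ε nA nB ρ n UA UB _ hA hB _ hU
    refine ⟨CostAtMost.localConj hA hB hU, fun h => ?_⟩
    have h' := CostAtMost.localConj hA hB (hU.inv hinv) h
    simpa only [localConj_inv_localConj] using h'
  · rintro ε n hε ⟨p, hp⟩ hn hlog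
    obtain ⟨UA, hUA⟩ := exists_not_costAtMost (eventually_exists_isHard hfin hp hn hlog)
    exact ⟨UA, fun _ => 1, costAtMost_eprState fun l => (hε l).1, hUA⟩
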